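/- Let $M\cong\mathbb Z^d$ be a lattice with dual lattice $N$, and let $\Delta\subset M_{\mathbb R}$ be a $d$-dimensional Gorenstein polytope of index $r\ge 1$, i.e. a lattice polytope such that $r\Delta$ has an interior lattice point $m$ for which $r\Delta-m$ is reflexive (the dual polytope $\{y\in N_{\mathbb R}:\langle y,x\rangle\ge -1\ \forall x\in r\Delta-m\}$ is a lattice polytope). Let $\sigma=\mathbb R_{\ge0}(\Delta\times\{1\})\subset M_{\mathbb R}\oplus\mathbb R$. Its dual cone $\sigma^\vee$ is generated by finitely many points of the lattice $N\oplus\mathbb Z$ lying on a hyperplane $\langle \bar m,\cdot\rangle=1$ for a unique $\bar m\in M\oplus\mathbb Z$; the dual Gorenstein polytope is $\Delta^*=\{y\in\sigma^\vee:\langle \bar m,y\rangle=1\}$, and a face $F$ of $\Delta$ has the dual face $F^*=\{y\in\Delta^*:\langle (x,1),y\rangle=0\ \forall x\in F\}$. For a lattice polytope $P$ with respect to a lattice $\Lambda$, let $h^*_P(t)=(1-t)^{\dim P+1}\sum_{k\ge0}|kP\cap \Lambda|\,t^k$ (with $h^*_\emptyset=1$, $\dim\emptyset=-1$) and $$\widetilde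 S(P,t)=\sum_{\emptyset\le F\le P}(-1)^{\dim P-\dim F}\,h^*_F(t)\,g_{[F,P]}(t),$$ where the sum is over all faces of $P$ (including $\emptyset$ and $P$) and $g$ is Stanley's $g$-polynomial of the interval $[F,P]$ in the face poset: $g=1$ for a poset of rank $0$, and for a poset with least element $\hat 0$, greatest element $\hat 1$ and rank $e>0$, $g$ is the part in degrees $<e/2$ of $(1-t)\sum_{\hat 0<x\le\hat 1}(t-1)^{\mathrm{rk}(x)-1}g_{[x,\hat 1]}(t)$. The stringy $E$-function of $\Delta$ is $$E_{\rm st}(\Delta;u,v)=(uv)^{-r}\sum_{\emptyset\le F\le\Delta}(-u)^{\dim F+1}\,\widetilde S(F,u^{-1}v)\,\widetilde S(F^*,uv)\in\mathbb Q(u,v).$$ If $\Delta$ is a lattice pyramid, i.e. $\Delta=\mathrm{Conv}(\Delta'\cup\{w\})$ for a lattice polytope $\Delta'$ and a lattice point $w$ at integral distance $1$ from $\Delta'$ (there are $f\in N$ and $c\in\mathbb Z$ with $f=c$ on $\Delta'$ and $f(w)=c+1$), then $E_{\rm st}(\Delta;u,v)=0$. -/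

import Mathlib

open Polynomial
open scoped Pointwise

noncomputable section

namespace StringyE

/-! ### Stanley's `g`- and `h`-polynomials of intervals in a finite poset -/

section Stanley

variable {α : Type*} [PartialOrder α]

/-- The rank of the interval `[x, y]`: the length of a longest chain in it (`0` if it is empty). -/
def rk (x y : α) : ℕ := ((Order.krullDim (Set.Icc x y)).unbotD 0).toNat

/-- The part of `p` in the degrees `i < d / 2`. -/
def lowerHalf (d : ℕ) (p : ℤ[X]) : ℤ[X] :=
  ∑ i ∈ (Finset.range d).filter (fun i => 2 * i < d), monomial i (p.coeff i)

/-- The `g`-polynomial of the interval `[x, y]` of a finite poset. If the interval has rank `0`, it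
is `1`. If it has rank `d > 0`, it is the part in degrees `< d / 2` of `(1 - t) h(t)`, where
`h(t) = ∑_{x < z ≤ y} (t - 1) ^ (rk [x, z] - 1) g_{[z, y]}(t)` is the `h`-polynomial. -/
def gPoly [Finite α] (x y : α) : ℤ[X] :=
  if rk x y = 0 then 1
  else lowerHalf (rk x y)
    ((1 - X) * ∑ᶠ z : Set.Ioc x y, (X - 1) ^ (rk x (z : α) - 1) * gPoly (z : α) y)
termination_by (Set.Icc x y).ncard
decreasing_by
  refine Set.ncard_lt_ncard ⟨Set.Icc_subset_Icc_left z.2.1.le, fun h => ?_⟩ (Set.toFinite _)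
  exact absurd (h ⟨le_rfl, z.2.1.le.trans z.2.2⟩).1 (not_le_of_gt z.2.1)

/-- The `h`-polynomial of the interval `[x, y]` of a finite poset. -/
def hPoly [Finite α] (x y : α) : ℤ[X] :=
  if rk x y = 0 then 1
  else ∑ᶠ z : Set.Ioc x y, (X - 1) ^ (rk x (z : α) - 1) * gPoly (z : α) y

theorem gPoly_eq [Finite α] (x y : α) :
    gPoly x y = if rk x y = 0 then 1 else lowerHalf (rk x y) ((1 - X) * hPoly x y) := by
  rw [gPoly]
  split_ifs with h
  · rfl
  · rw [hPoly, if_neg h]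

end Stanley

/-! ### Lattices, lattice polytopes, faces -/

section Polytopes

variable {V : Type*} [AddCommGroup V] [Module ℝ V]

/-- The dual lattice: the linear forms that are integral on `Λ`. -/
def dualLattice (Λ : Submodule ℤ V) : Submodule ℤ (Module.Dual ℝ V) where
  carrier := {f | ∀ x ∈ Λ, ∃ k : ℤ, f x = k}
  zero_mem' := fun _ _ => ⟨0, by simp⟩
  add_mem' := by
    intro f g hf hg x hx
    obtain ⟨a, ha⟩ := hf x hx
    obtain ⟨b, hb⟩ := hg x hx
    exact ⟨a + b, by simp [ha, hb]⟩
  smul_mem' := by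
    intro c f hf x hx
    obtain ⟨a, ha⟩ := hf x hx
    exact ⟨c * a, by simp [ha]⟩

/-- `P` is a lattice polytope: the convex hull of finitely many points of `Λ` (possibly none). -/
def IsLatticePolytope (Λ : Submodule ℤ V) (P : Set V) : Prop :=
  ∃ s : Set V, s.Finite ∧ s ⊆ Λ ∧ P = convexHull ℝ s

/-- `F` is a face of the polytope `P`: the set of points of `P` where an inequality
`c ≤ f x` that is valid on `P` is an equality. Both `∅` and `P` are faces. -/
def IsFace (P F : Set V) : Prop :=
  ∃ (f : Module.Dual ℝ V) (c : ℝ), (∀ x ∈ P, c ≤ f x) ∧ F = {x ∈ P | f x = c}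

/-- The faces of `P`, including `∅` and `P`, ordered by inclusion. -/
abbrev Face (P : Set V) : Type _ := {F : Set V // IsFace P F}

theorem isFace_empty (P : Set V) : IsFace P ∅ :=
  ⟨0, -1, fun _ _ => by simp, by ext x; simp⟩

theorem isFace_self (P : Set V) : IsFace P P :=
  ⟨0, 0, fun _ _ => by simp, by ext x; simp⟩

/-- A face of a polytope is the convex hull of the generators that lie on it. -/
theorem IsFace.eq_convexHull {s F : Set V} (h : IsFace (convexHull ℝ s) F) :
    F = convexHull ℝ (s ∩ F) := by
  obtain ⟨f, c, hc, rfl⟩ := h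
  apply Set.Subset.antisymm
  · let Q : Set V := {x | c < f x} ∪ convexHull ℝ (s ∩ {x ∈ convexHull ℝ s | f x = c})
    have hK : ∀ x ∈ convexHull ℝ (s ∩ {x ∈ convexHull ℝ s | f x = c}), f x = c := by
      have : convexHull ℝ (s ∩ {x ∈ convexHull ℝ s | f x = c}) ⊆ {x | f x = c} :=
        convexHull_min (fun x hx => hx.2.2) (convex_hyperplane f.isLinear c)
      exact fun x hx => this hx
    have hQ : Convex ℝ Q := by
      intro x hx y hy a b ha hb hab
      have hge : ∀ z ∈ Q, c ≤ f z := by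
        rintro z (hz | hz)
        · exact le_of_lt hz
        · exact (hK z hz).ge
      rcases ha.eq_or_lt with rfl | ha'
      · simpa [show b = 1 by linarith] using hy
      rcases hb.eq_or_lt with rfl | hb'
      · simpa [show a = 1 by linarith] using hx
      have key : f (a • x + b • y) = c + a * (f x - c) + b * (f y - c) := by
        simp only [map_add, map_smul, smul_eq_mul]
        linear_combination c * hab
      have h1 := hge x hx
      have h2 := hge y hy
      rcases hx with hx | hx
      · left
        change c < f (a • x + b • y)
        have h3 : 0 < a * (f x - c) := mul_pos ha' (sub_pos.2 hx)
        have h4 : 0 ≤ b * (f y - c) := mul_nonneg hb (sub_nonneg.2 h2)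
        rw [key]; linarith
      · rcases hy with hy | hy
        · left
          change c < f (a • x + b • y)
          have h3 : 0 < b * (f y - c) := mul_pos hb' (sub_pos.2 hy)
          have h4 : 0 ≤ a * (f x - c) := mul_nonneg ha (sub_nonneg.2 h1)
          rw [key]; linarith
        · exact Or.inr (convex_convexHull ℝ _ hx hy ha hb hab)
    have hsQ : s ⊆ Q := by
      intro x hx
      have hx' := subset_convexHull ℝ s hx
      rcases (hc x hx').eq_or_lt with h | h
      · exact Or.inr (subset_convexHull ℝ _ ⟨hx, hx', h.symm⟩)
      · exact Or.inl h
    rintro x ⟨hx, hxc⟩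
    rcases convexHull_min hsQ hQ hx with h | h
    · exact absurd hxc (ne_of_gt h)
    · exact h
  · refine convexHull_min Set.inter_subset_right ?_
    exact (convex_convexHull ℝ s).inter (convex_hyperplane f.isLinear c)

/-- A polytope has finitely many faces. -/
theorem IsLatticePolytope.finite_face {Λ : Submodule ℤ V} {P : Set V}
    (hP : IsLatticePolytope Λ P) : Finite (Face P) := by
  obtain ⟨s, hs, -, rfl⟩ := hP
  have : Finite (𝒫 s) := hs.finite_subsets
  refine Finite.of_injective
    (fun F : Face (convexHull ℝ s) => (⟨s ∩ F.1, Set.inter_subset_left⟩ : 𝒫 s)) ?_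
  intro F G h
  have h' : s ∩ F.1 = s ∩ G.1 := congrArg Subtype.val h
  apply Subtype.ext
  rw [F.2.eq_convexHull, G.2.eq_convexHull, h']

open Classical in
/-- `dim P + 1`, with the convention `dim ∅ = -1`. -/
def dimSucc (P : Set V) : ℕ :=
  if P.Nonempty then Module.finrank ℝ (vectorSpan ℝ P) + 1 else 0

/-- `P` is a lattice pyramid: the convex hull of a lattice polytope `P'` (the base) and a lattice
point `v` (the apex) at integral distance `1` from the base, as measured by a form `f` of the dual
lattice. -/
def IsLatticePyramid (Λ : Submodule ℤ V) (P : Set V) : Prop :=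
  ∃ (P' : Set V) (v : V) (f : Module.Dual ℝ V) (c : ℤ),
    IsLatticePolytope Λ P' ∧ v ∈ Λ ∧ f ∈ dualLattice Λ ∧
    (∀ x ∈ P', f x = c) ∧ f v = c + 1 ∧ P = convexHull ℝ (insert v P')

/-! ### The `h^*`- and the `S̃`-polynomial of a lattice polytope -/

/-- The power series `(1 - t) ^ (dim P + 1) * ∑ k, |k P ∩ Λ| t ^ k`. -/
def ehrhartNumerator (Λ : Submodule ℤ V) (P : Set V) : PowerSeries ℤ :=
  (1 - PowerSeries.X) ^ dimSucc P *
    PowerSeries.mk (fun k : ℕ => (((((k : ℝ) • P) ∩ (Λ : Set V)).ncard : ℕ) : ℤ))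

open Classical in
/-- The `h^*`-polynomial of a lattice polytope: the polynomial that equals
`(1 - t) ^ (dim P + 1) * ∑ k, |k P ∩ Λ| t ^ k` as a power series, and `1` for `P = ∅`. The junk
value `0` is never taken on a lattice polytope with respect to a lattice. -/
def hStar (Λ : Submodule ℤ V) (P : Set V) : ℤ[X] :=
  if P = ∅ then 1
  else if h : ∃ p : ℤ[X], (p : PowerSeries ℤ) = ehrhartNumerator Λ P then h.choose
  else 0

open Classical in
/-- The polynomial `S̃(P, t) = ∑_{∅ ≤ F ≤ P} (-1) ^ (dim P - dim F) h^*_F(t) g_{[F, P]}(t)`, where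
`[F, P]` is an interval in the poset of faces of `P`. This poset is finite for every polytope, so
the value `0` in the other case plays no role. -/
def sTilde (Λ : Submodule ℤ V) (P : Set V) : ℤ[X] :=
  if _h : Finite (Face P) then
    ∑ᶠ F : Face P, (-1) ^ (dimSucc P - dimSucc F.1) * hStar Λ F.1 *
      gPoly F (⟨P, isFace_self P⟩ : Face P)
  else 0

end Polytopes

/-! ### Gorenstein polytopes and their duality -/

section Gorenstein

variable {E : Type*} [NormedAddCommGroup E] [NormedSpace ℝ E]

/-- The dual polytope `{y | ⟨y, x⟩ ≥ -1 for all x ∈ P}`. -/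
def polarDual (P : Set E) : Set (Module.Dual ℝ E) := {y | ∀ x ∈ P, -1 ≤ y x}

/-- `P` is reflexive: a lattice polytope with `0` in its interior whose dual polytope is a lattice
polytope for the dual lattice. -/
def IsReflexive (L : Submodule ℤ E) (P : Set E) : Prop :=
  IsLatticePolytope L P ∧ (0 : E) ∈ interior P ∧ IsLatticePolytope (dualLattice L) (polarDual P)

/-- `Δ` is a (full-dimensional) Gorenstein polytope of index `r`: a lattice polytope such that
`r Δ` has an interior lattice point `m` for which `r Δ - m` is reflexive. -/
def IsGorenstein (L : Submodule ℤ E) (Δ : Set E) (r : ℕ) : Prop :=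
  0 < r ∧ IsLatticePolytope L Δ ∧
    ∃ m ∈ L, m ∈ interior ((r : ℝ) • Δ) ∧ IsReflexive L ((fun x => x - m) '' ((r : ℝ) • Δ))

/-- The lattice `L ⊕ ℤ` in `E × ℝ`. -/
def liftLattice (L : Submodule ℤ E) : Submodule ℤ (E × ℝ) :=
  L.prod (Submodule.span ℤ {(1 : ℝ)})

/-- The cone `ℝ_{≥ 0} (Δ × {1})` in `E × ℝ`. -/
def coneOver (Δ : Set E) : PointedCone ℝ (E × ℝ) := PointedCone.hull ℝ (Δ ×ˢ {(1 : ℝ)})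

/-- The dual `{y | ⟨y, x⟩ ≥ 0 for all x in the cone}` of the cone over `Δ`. -/
def dualCone (Δ : Set E) : PointedCone ℝ (Module.Dual ℝ (E × ℝ)) :=
  PointedCone.dual (Module.Dual.eval ℝ (E × ℝ)) (coneOver Δ : Set (E × ℝ))

/-- The dual cone is generated by finitely many points of the dual lattice on the hyperplane
`⟨y, m⟩ = 1`, where `m` is a lattice point. -/
def IsDualGrading (L : Submodule ℤ E) (Δ : Set E) (m : E × ℝ) : Prop :=
  m ∈ liftLattice L ∧ ∃ S : Set (Module.Dual ℝ (E × ℝ)), S.Finite ∧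
    S ⊆ dualLattice (liftLattice L) ∧ (∀ y ∈ S, y m = 1) ∧ dualCone Δ = PointedCone.hull ℝ S

/-- The dual Gorenstein polytope `Δ^*`: the support of the dual cone, that is, its slice
`⟨y, m⟩ = 1`, where `m` is the (unique) lattice point as in `IsDualGrading`. Its lattice points are
those of `dualLattice (liftLattice L)`. -/
def dualPolytope (L : Submodule ℤ E) (Δ : Set E) : Set (Module.Dual ℝ (E × ℝ)) :=
  {y | y ∈ dualCone Δ ∧ ∃ m, IsDualGrading L Δ m ∧ y m = 1}

/-- The face `F^*` of `Δ^*` dual to the face `F` of `Δ`. -/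
def dualFace (L : Submodule ℤ E) (Δ F : Set E) : Set (Module.Dual ℝ (E × ℝ)) :=
  {y ∈ dualPolytope L Δ | ∀ x ∈ F, y (x, 1) = 0}

/-! ### The stringy `E`-function -/

/-- The field `ℚ(u, v)` of rational functions in two independent variables. -/
abbrev RatUV : Type := FractionRing (MvPolynomial (Fin 2) ℚ)

/-- The variable `u`. -/
def varU : RatUV := algebraMap (MvPolynomial (Fin 2) ℚ) RatUV (MvPolynomial.X 0)

/-- The variable `v`. -/
def varV : RatUV := algebraMap (MvPolynomial (Fin 2) ℚ) RatUV (MvPolynomial.X 1)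

/-- The stringy `E`-function of a Gorenstein polytope `Δ` of index `r`,
`(u v) ^ (-r) ∑_{∅ ≤ F ≤ Δ} (-u) ^ (dim F + 1) S̃(F, u⁻¹ v) S̃(F^*, u v)`. -/
def Est (L : Submodule ℤ E) (Δ : Set E) (r : ℕ) : RatUV :=
  ((varU * varV) ^ r)⁻¹ * ∑ᶠ F : Face Δ, (-varU) ^ dimSucc F.1 *
    aeval (varU⁻¹ * varV) (sTilde L F.1) *
    aeval (varU * varV) (sTilde (dualLattice (liftLattice L)) (dualFace L Δ F.1))

end Gorenstein

end StringyE

end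

noncomputable section

namespace StringyE

/-! ### Stanley's `g`-polynomial of the product of a poset with a two-element chain. -/

section Stanley

variable {α β : Type*} [PartialOrder α] [PartialOrder β]

/-! Every summand of `Est` vanishes, because one of its two `S̃`-factors is that of a lattice
pyramid.

`S̃` kills lattice pyramids (`sTilde_pyr`). The faces of a pyramid over `P` are the faces `F` of `P`
and the pyramids over them, so the face poset is a product with a two-element chain
(`IsHeight.faceIso`). Coning changes neither `h^*` (`hStar_pyr`) nor `g` (`gPoly_false_true`), while
the dimension of `F` goes up by one. The terms of `F` and of its pyramid therefore cancel.

Let `v` be the apex of `Δ` and `B` its base. A face through `v` is a lattice pyramid over its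
intersection with `B`. For a face `F` that misses `v`, hence lies in `B`, it is `F^*` that is a
lattice pyramid (`dualFace_eq_pyr`). Its apex is the form `e = (f, -c)`, which is `0` on `B × {1}`
and `1` at `(v, 1)`; its base is the part of `F^*` vanishing at `(v, 1)`, and evaluation at `(v, 1)`
measures the height. The decisive point is that `e` lies in `Δ^*`, i.e. has degree `1` for the dual
grading (`affForm_apply_grading`). The grading itself comes from reflexivity
(`IsGorenstein.exists_isDualGrading`). -/

theorem rk_eq_of_orderIso {x y : α} {x' y' : β} (e : Set.Icc x y ≃o Set.Icc x' y') :
    rk x y = rk x' y' := by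
  rw [rk, rk, Order.krullDim_eq_of_orderIso e]

theorem coe_rk [Finite α] {x y : α} (h : x ≤ y) :
    ((rk x y : ℕ∞) : WithBot ℕ∞) = Order.krullDim (Set.Icc x y) := by
  have : Nonempty (Set.Icc x y) := ⟨⟨x, le_rfl, h⟩⟩
  have hle : Order.krullDim (Set.Icc x y) ≤ (Nat.card (Set.Icc x y) : ℕ) :=
    iSup_le fun l => by
      have := Nat.card_le_card_of_injective l l.strictMono.injective
      rw [Nat.card_fin] at this
      exact_mod_cast (Nat.le_succ _).trans this
  obtain ⟨a, ha⟩ := WithBot.ne_bot_iff_exists.1 (Order.bot_lt_krullDim (α := Set.Icc x y)).ne'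
  rw [rk, ← ha]
  rw [← ha] at hle
  have hle' : a ≤ (Nat.card (Set.Icc x y) : ℕ) := by exact_mod_cast hle
  have hne : a ≠ ⊤ := ne_top_of_le_ne_top (ENat.natCast_ne_top _) hle'
  rw [WithBot.unbotD_coe, ENat.natCast_toNat hne]

theorem rk_self [Finite α] (x : α) : rk x x = 0 := by
  have h := coe_rk (le_refl x)
  have : Nonempty (Set.Icc x x) := ⟨⟨x, le_rfl, le_rfl⟩⟩
  have : Subsingleton (Set.Icc x x) := by
    rw [Set.Icc_self]; infer_instance
  rw [Order.krullDim_eq_zero] at h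
  exact_mod_cast h

theorem rk_ne_zero [Finite α] {x y : α} (h : x < y) : rk x y ≠ 0 := by
  intro h0
  have h1 := coe_rk h.le
  have : 0 < Order.krullDim (Set.Icc x y) :=
    Order.krullDim_pos_iff.2 ⟨⟨x, le_rfl, h.le⟩, ⟨y, h.le, le_rfl⟩, h⟩
  rw [← h1, h0] at this
  simp at this

theorem rk_eq_of_orderEmbedding (f : α ↪o β) {x y : α}
    (hf : ∀ b, f x ≤ b → b ≤ f y → b ∈ Set.range f) : rk (f x) (f y) = rk x y := by
  symm
  refine rk_eq_of_orderIso (RelIso.mk (Equiv.ofBijective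
    (fun z => (⟨f z.1, f.le_iff_le.2 z.2.1, f.le_iff_le.2 z.2.2⟩ : Set.Icc (f x) (f y)))
    ⟨fun a b h => ?_, fun b => ?_⟩) ?_)
  · exact Subtype.ext (f.injective (congrArg Subtype.val h))
  · obtain ⟨a, ha⟩ := hf b b.2.1 b.2.2
    refine ⟨⟨a, ?_, ?_⟩, Subtype.ext ha⟩
    · exact f.le_iff_le.1 (ha ▸ b.2.1)
    · exact f.le_iff_le.1 (ha ▸ b.2.2)
  · intro a b
    exact f.le_iff_le

/-- The sum `∑_{x < z ≤ y} (t - 1) ^ (rk [x, z] - 1) g_{[z, y]}(t)`, which vanishes for `x = y`. -/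
def hSum [Finite α] (x y : α) : ℤ[X] :=
  ∑ᶠ z ∈ Set.Ioc x y, (X - 1) ^ (rk x z - 1) * gPoly z y

theorem gPoly_self [Finite α] (x : α) : gPoly x x = 1 := by
  rw [gPoly_eq, if_pos (rk_self x)]

theorem gPoly_of_lt [Finite α] {x y : α} (h : x < y) :
    gPoly x y = lowerHalf (rk x y) ((1 - X) * hSum x y) := by
  rw [gPoly_eq, if_neg (rk_ne_zero h), hPoly, if_neg (rk_ne_zero h), hSum,
    finsum_set_coe_eq_finsum_mem (s := Set.Ioc x y)
      (f := fun z => (X - 1) ^ (rk x z - 1) * gPoly z y)]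

theorem hSum_self [Finite α] (x : α) : hSum x x = 0 := by
  simp [hSum]

/-- The `g`-polynomial of an interval only depends on the interval. -/
theorem gPoly_orderEmbedding [Finite α] [Finite β] (f : α ↪o β) {y : α} (x : α) (hxy : x ≤ y)
    (hf : ∀ b, f x ≤ b → b ≤ f y → b ∈ Set.range f) : gPoly (f x) (f y) = gPoly x y := by
  induction x using (wellFounded_gt (α := α)).induction with
  | _ x ih =>
    rcases hxy.eq_or_lt with rfl | hlt
    · rw [gPoly_self, gPoly_self]
    rw [gPoly_of_lt hlt, gPoly_of_lt (f.lt_iff_lt.2 hlt), rk_eq_of_orderEmbedding f hf, hSum, hSum]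
    congr 2
    have himg : Set.Ioc (f x) (f y) = f '' Set.Ioc x y := by
      ext b
      constructor
      · rintro ⟨h1, h2⟩
        obtain ⟨a, rfl⟩ := hf b h1.le h2
        exact ⟨a, ⟨f.lt_iff_lt.1 h1, f.le_iff_le.1 h2⟩, rfl⟩
      · rintro ⟨a, ⟨h1, h2⟩, rfl⟩
        exact ⟨f.lt_iff_lt.2 h1, f.le_iff_le.2 h2⟩
    rw [himg, finsum_mem_image f.injective.injOn]
    refine finsum_mem_congr rfl fun z hz => ?_
    rw [ih z hz.1 hz.2 fun b h1 h2 => hf b ((f.le_iff_le.2 hz.1.le).trans h1) h2,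
      rk_eq_of_orderEmbedding f fun b h1 h2 => hf b h1 (h2.trans (f.le_iff_le.2 hz.2))]

theorem gPoly_orderIso [Finite α] [Finite β] (e : α ≃o β) {x y : α} (hxy : x ≤ y) :
    gPoly (e x) (e y) = gPoly x y :=
  gPoly_orderEmbedding e.toOrderEmbedding x hxy fun b _ _ => ⟨e.symm b, by simp⟩

/-- The embedding of a poset as a level of its product with a two-element chain. -/
def levelEmbedding (α : Type*) [PartialOrder α] (b : Bool) : α ↪o α × Bool where
  toFun z := (z, b)
  inj' _ _ h := congrArg Prod.fst h
  map_rel_iff' := ⟨fun h => h.1, fun h => ⟨h, le_rfl⟩⟩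

theorem levelEmbedding_apply (b : Bool) (z : α) : levelEmbedding α b z = (z, b) := rfl

theorem rk_level (b : Bool) (x y : α) : rk (x, b) (y, b) = rk x y :=
  rk_eq_of_orderEmbedding (levelEmbedding α b) fun z h1 h2 =>
    ⟨z.1, Prod.ext rfl (le_antisymm h1.2 h2.2)⟩

theorem gPoly_level [Finite α] (b : Bool) {x y : α} (h : x ≤ y) :
    gPoly (x, b) (y, b) = gPoly x y :=
  gPoly_orderEmbedding (levelEmbedding α b) x h fun z h1 h2 =>
    ⟨z.1, Prod.ext rfl (le_antisymm h1.2 h2.2)⟩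

theorem krullDim_le_of_strictMono_nat {n : ℕ} (f : α → ℕ) (hf : StrictMono f) (hn : ∀ a, f a ≤ n) :
    Order.krullDim α ≤ n := by
  refine iSup_le fun l => ?_
  have h := Order.length_le_height_last (p := l.map f hf)
  rw [Order.height_nat] at h
  have h2 : (l.map f hf).last ≤ n := hn _
  have h3 : l.length ≤ (l.map f hf).last := by exact_mod_cast h
  exact_mod_cast h3.trans h2

/-- Upper bound: the height of the first coordinate plus the level is strictly monotone. Lower
bound: a longest chain on the lower level is prolonged by `(y, true)`. -/
theorem rk_false_true [Finite α] {x y : α} (h : x ≤ y) :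
    rk (x, false) (y, true) = rk x y + 1 := by
  have hle : ((x, false) : α × Bool) ≤ (y, true) := ⟨h, Bool.false_le _⟩
  apply le_antisymm
  · have key : Order.krullDim (Set.Icc ((x, false) : α × Bool) (y, true)) ≤ (rk x y + 1 : ℕ) := by
      have hfin : ∀ a : Set.Icc x y, Order.height a ≤ (rk x y : ℕ∞) := fun a => by
        have := Order.height_le_krullDim a
        rw [← coe_rk h] at this
        exact_mod_cast this
      have hne : ∀ a : Set.Icc x y, Order.height a ≠ ⊤ := fun a =>
        ne_top_of_le_ne_top (ENat.natCast_ne_top _) (hfin a)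
      refine krullDim_le_of_strictMono_nat
        (fun z => (Order.height (⟨z.1.1, z.2.1.1, z.2.2.1⟩ : Set.Icc x y)).toNat + z.1.2.toNat)
        ?_ ?_
      · rintro ⟨⟨a, i⟩, ha⟩ ⟨⟨b, j⟩, hb⟩ hab
        have hab' : ((a, i) : α × Bool) < (b, j) := hab
        rcases Prod.lt_iff.1 hab' with ⟨h1, h2⟩ | ⟨h1, h2⟩
        · have h3 := Order.height_strictMono (x := (⟨a, ha.1.1, ha.2.1⟩ : Set.Icc x y))
            (y := ⟨b, hb.1.1, hb.2.1⟩) h1 (lt_top_iff_ne_top.2 (hne _))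
          have h4 := h3
          rw [← ENat.natCast_toNat (hne ⟨a, ha.1.1, ha.2.1⟩), ← ENat.natCast_toNat (hne ⟨b, hb.1.1, hb.2.1⟩),
            Nat.cast_lt] at h4
          have h5 : i.toNat ≤ j.toNat := Bool.toNat_le_toNat h2
          dsimp only at *
          omega
        · have h3 := Order.height_mono (α := Set.Icc x y)
            (a := (⟨a, ha.1.1, ha.2.1⟩ : Set.Icc x y)) (b := ⟨b, hb.1.1, hb.2.1⟩) h1
          have h4 := ENat.toNat_le_toNat h3 (hne _)
          have h5 : i.toNat < j.toNat := by
            obtain ⟨rfl, rfl⟩ := Bool.lt_iff.1 h2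
            decide
          dsimp only at *
          omega
      · rintro ⟨⟨a, i⟩, ha⟩
        have h1 := ENat.toNat_le_toNat (hfin ⟨a, ha.1.1, ha.2.1⟩) (ENat.natCast_ne_top _)
        have h2 : i.toNat ≤ 1 := Bool.toNat_le i
        simp only [ENat.toNat_natCast] at h1
        dsimp only at *
        omega
    rw [← coe_rk hle] at key
    exact_mod_cast key
  · have h1 := (coe_rk h).le
    obtain ⟨l, hl⟩ := Order.le_krullDim_iff.1 h1
    let g : Set.Icc x y → Set.Icc ((x, false) : α × Bool) (y, true) :=
      fun z => ⟨(z.1, false), ⟨z.2.1, le_rfl⟩, ⟨z.2.2, Bool.false_le _⟩⟩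
    have hg : StrictMono g := fun a b hab => (levelEmbedding α false).lt_iff_lt.2 hab
    let l' := (l.map g hg).snoc ⟨(y, true), hle, le_rfl⟩ (by
      change ((l.last.1, false) : α × Bool) < (y, true)
      exact Prod.lt_iff.2 (Or.inr ⟨l.last.2.2, Bool.false_lt_true⟩))
    have h2 := Order.LTSeries.length_le_krullDim l'
    rw [← coe_rk hle] at h2
    have h3 : l'.length = rk x y + 1 := by
      simp [l', hl]
    rw [h3] at h2
    exact_mod_cast h2

theorem coeff_lowerHalf (d : ℕ) (p : ℤ[X]) (n : ℕ) :
    (lowerHalf d p).coeff n = if 2 * n < d then p.coeff n else 0 := by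
  rw [lowerHalf, finsetSum_coeff]
  simp only [coeff_monomial]
  rw [Finset.sum_ite_eq']
  simp only [Finset.mem_filter, Finset.mem_range]
  congr 1
  apply propext
  omega

/-- Here `q` is the `h`-polynomial of the base and `g + X * q` that of the pyramid. Since `(1 - X) *
(g + X * q) = g + X * ((1 - X) * q - g)`, the correction to `g` vanishes in the degrees kept by the
truncation; above them `g` itself has no coefficients. -/
theorem lowerHalf_pyramid {d : ℕ} {g q : ℤ[X]} (h : g = lowerHalf d ((1 - X) * q)) :
    lowerHalf (d + 1) ((1 - X) * (g + X * q)) = g := by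
  have hc : ∀ n, g.coeff n = if 2 * n < d then ((1 - X) * q).coeff n else 0 := fun n => by
    conv_lhs => rw [h, coeff_lowerHalf]
  ext n
  rw [coeff_lowerHalf]
  have e : (1 - X) * (g + X * q) = g + X * ((1 - X) * q - g) := by ring
  rw [e]
  cases n with
  | zero =>
    simp only [coeff_add, mul_coeff_zero, coeff_X_zero, zero_mul, add_zero]
    simp
  | succ n =>
    rw [coeff_add, coeff_X_mul, coeff_sub, hc n, hc (n + 1)]
    split_ifs <;> omega

/-- The `g`-polynomial of a pyramid is the one of its base. -/
theorem gPoly_false_true [Finite α] {y : α} (x : α) (hxy : x ≤ y) :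
    gPoly (x, false) (y, true) = gPoly x y := by
  induction x using (wellFounded_gt (α := α)).induction with
  | _ x ih =>
    have hlt : ((x, false) : α × Bool) < (y, true) :=
      Prod.lt_iff.2 (Or.inr ⟨hxy, Bool.false_lt_true⟩)
    have hIoc : Set.Ioc ((x, false) : α × Bool) (y, true) =
        levelEmbedding α false '' Set.Ioc x y ∪
          levelEmbedding α true '' insert x (Set.Ioc x y) := by
      rw [Set.Ioc_insert_left hxy]
      ext ⟨z, b⟩
      constructor
      · rintro ⟨h1, h2⟩
        cases b with
        | false =>
          rcases Prod.lt_iff.1 h1 with h | h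
          · exact Or.inl ⟨z, ⟨h.1, h2.1⟩, rfl⟩
          · exact absurd h.2 (lt_irrefl _)
        | true => exact Or.inr ⟨z, ⟨h1.le.1, h2.1⟩, rfl⟩
      · rintro (⟨w, hw, h⟩ | ⟨w, hw, h⟩) <;> obtain ⟨rfl, rfl⟩ := Prod.ext_iff.1 h
        · exact ⟨Prod.lt_iff.2 (Or.inl ⟨hw.1, le_rfl⟩), hw.2, Bool.false_le _⟩
        · exact ⟨Prod.lt_iff.2 (Or.inr ⟨hw.1, Bool.false_lt_true⟩), hw.2, le_rfl⟩
    -- The lower level contributes `hSum x y` by induction. On the upper level `(x, true)`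
    -- contributes `gPoly x y`, and the other elements `(X - 1) * hSum x y`, their rank being one
    -- larger.
    have hsum : hSum (x, false) (y, true) = gPoly x y + X * hSum x y := by
      rw [hSum, hIoc, finsum_mem_union _ (Set.toFinite _) (Set.toFinite _),
        finsum_mem_image (levelEmbedding α false).injective.injOn,
        finsum_mem_image (levelEmbedding α true).injective.injOn,
        finsum_mem_insert _ (by simp) (Set.toFinite _)]
      · simp only [levelEmbedding_apply, rk_level, rk_false_true le_rfl, rk_self]
        have h1 : ∑ᶠ z ∈ Set.Ioc x y, (X - 1) ^ (rk x z - 1) * gPoly (z, false) (y, true) =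
            hSum x y := finsum_mem_congr rfl fun z hz => by rw [ih z hz.1 hz.2]
        have h2 : ∑ᶠ z ∈ Set.Ioc x y,
            (X - 1) ^ (rk (x, false) (z, true) - 1) * gPoly (z, true) (y, true) =
            (X - 1) * hSum x y := by
          rw [hSum, mul_finsum_mem]
          refine finsum_mem_congr rfl fun z hz => ?_
          rw [rk_false_true hz.1.le, gPoly_level true hz.2, Nat.add_sub_cancel, ← mul_assoc,
            ← pow_succ', Nat.sub_add_cancel (Nat.one_le_iff_ne_zero.2 (rk_ne_zero hz.1))]
        rw [h1, h2, gPoly_level true hxy]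
        ring
      · rw [Set.disjoint_left]
        rintro _ ⟨a, -, rfl⟩ ⟨b, -, h⟩
        exact absurd (congrArg Prod.snd h) (by simp [levelEmbedding_apply])
    rw [gPoly_of_lt hlt, hsum, rk_false_true hxy]
    -- For `x = y` the value `1` of `g` is a convention and not a truncation, so `lowerHalf_pyramid`
    -- does not apply.
    rcases hxy.eq_or_lt with rfl | h
    · rw [hSum_self, rk_self, gPoly_self]
      ext n
      rw [coeff_lowerHalf]
      rcases n with _ | n
      · simp
      · simp [coeff_one]
    · exact lowerHalf_pyramid (gPoly_of_lt h)

end Stanley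

/-! ### Pyramids: faces, lattice points, and the vanishing of `S̃`. -/

section Pyramids

variable {V : Type*} [AddCommGroup V] [Module ℝ V]

theorem IsFace.subset {P F : Set V} (h : IsFace P F) : F ⊆ P := by
  obtain ⟨g, d, -, rfl⟩ := h
  exact fun x hx => hx.1

theorem IsFace.convex {P F : Set V} (h : IsFace P F) (hP : Convex ℝ P) : Convex ℝ F := by
  obtain ⟨g, d, -, rfl⟩ := h
  exact hP.inter (convex_hyperplane g.isLinear d)

/-- The pyramid over `P` with apex `v`. -/
def pyr (v : V) (P : Set V) : Set V := convexHull ℝ (insert v P)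

theorem apex_mem_pyr (v : V) (P : Set V) : v ∈ pyr v P :=
  subset_convexHull ℝ _ (Set.mem_insert _ _)

theorem subset_pyr (v : V) (P : Set V) : P ⊆ pyr v P :=
  (Set.subset_insert _ _).trans (subset_convexHull ℝ _)

theorem pyr_mono (v : V) {P Q : Set V} (h : P ⊆ Q) : pyr v P ⊆ pyr v Q :=
  convexHull_mono (Set.insert_subset_insert h)

theorem convex_pyr (v : V) (P : Set V) : Convex ℝ (pyr v P) := convex_convexHull ℝ _

/-- Splitting off the apex keeps `1 - s` positive elsewhere and covers the empty base, whose pyramid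
is a point. -/
theorem mem_pyr {v : V} {P : Set V} (hP : Convex ℝ P) {x : V} :
    x ∈ pyr v P ↔ x = v ∨ ∃ p ∈ P, ∃ s : ℝ, 0 ≤ s ∧ s < 1 ∧ x = (1 - s) • p + s • v := by
  constructor
  · intro hx
    rcases P.eq_empty_or_nonempty with rfl | hne
    · left
      simpa [pyr] using hx
    · rw [pyr, convexHull_insert hne, hP.convexHull_eq, mem_convexJoin] at hx
      obtain ⟨_, rfl, p, hp, a, b, ha, hb, hab, rfl⟩ := hx
      rcases hb.eq_or_lt with rfl | hb'
      · left
        simp [show a = 1 by linarith]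
      · refine Or.inr ⟨p, hp, a, ha, by linarith, ?_⟩
        rw [show 1 - a = b by linarith, add_comm]
  · rintro (rfl | ⟨p, hp, s, h0, h1, rfl⟩)
    · exact apex_mem_pyr _ _
    · exact convex_pyr v P (subset_pyr v P hp) (apex_mem_pyr v P) (by linarith) h0 (by linarith)

/-- `f` separates the apex `v` from the base `P`: it is constant on `P` and takes a value at `v`
that is larger by `1`. -/
structure IsHeight (f : Module.Dual ℝ V) (c : ℝ) (v : V) (P : Set V) : Prop where
  base : ∀ x ∈ P, f x = c
  apex : f v = c + 1

section Height

variable {f : Module.Dual ℝ V} {c : ℝ} {v : V} {P F G : Set V}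

theorem IsHeight.mono (h : IsHeight f c v P) (hF : F ⊆ P) : IsHeight f c v F :=
  ⟨fun x hx => h.base x (hF hx), h.apex⟩

theorem IsHeight.apply_comb (h : IsHeight f c v P) {p : V} (hp : p ∈ P) (s : ℝ) :
    f ((1 - s) • p + s • v) = c + s := by
  simp only [map_add, map_smul, smul_eq_mul, h.base p hp, h.apex]
  ring

theorem IsHeight.le_apply (h : IsHeight f c v P) (hP : Convex ℝ P) {x : V} (hx : x ∈ pyr v P) :
    c ≤ f x := by
  rcases (mem_pyr hP).1 hx with rfl | ⟨p, hp, s, h0, h1, rfl⟩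
  · rw [h.apex]; linarith
  · rw [h.apply_comb hp]; linarith

theorem IsHeight.apex_notMem (h : IsHeight f c v P) : v ∉ P := fun hv => by
  have := h.base v hv
  rw [h.apex] at this
  linarith

theorem IsHeight.pyr_inter (h : IsHeight f c v P) (hF : F ⊆ P) (hFc : Convex ℝ F) :
    pyr v F ∩ P = F := by
  refine Set.Subset.antisymm ?_ (Set.subset_inter (subset_pyr v F) hF)
  rintro x ⟨hx, hxP⟩
  rcases (mem_pyr hFc).1 hx with rfl | ⟨p, hp, s, h0, h1, rfl⟩
  · exact absurd hxP h.apex_notMem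
  · have h2 := h.base _ hxP
    rw [h.apply_comb (hF hp)] at h2
    obtain rfl : s = 0 := by linarith
    simpa using hp

theorem IsFace.pyr_base (h : IsHeight f c v P) (hP : Convex ℝ P) (hF : IsFace P F) :
    IsFace (pyr v P) F := by
  obtain ⟨g, d, hd, rfl⟩ := hF
  -- Adding a multiple of `f` only shifts `g` on the base; this `t` puts the apex one above the
  -- minimum, so that it is not on the face.
  set t := d + 1 - g v
  have hv : (g + t • f) v = d + t * c + 1 := by
    simp only [LinearMap.add_apply, LinearMap.smul_apply, smul_eq_mul, h.apex, t]
    ring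
  have hp : ∀ p ∈ P, ∀ s : ℝ, (g + t • f) ((1 - s) • p + s • v) =
      d + t * c + ((1 - s) * (g p - d) + s) := fun p hp s => by
    rw [map_add, map_smul, map_smul, hv, LinearMap.add_apply, LinearMap.smul_apply, h.base p hp]
    simp only [smul_eq_mul]
    ring
  refine ⟨g + t • f, d + t * c, fun x hx => ?_, ?_⟩
  · rcases (mem_pyr hP).1 hx with rfl | ⟨p, hpP, s, h0, h1, rfl⟩
    · rw [hv]; linarith
    · rw [hp p hpP]
      have := mul_nonneg (sub_nonneg.2 h1.le) (sub_nonneg.2 (hd p hpP))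
      linarith
  · ext x
    constructor
    · rintro ⟨hx, hgx⟩
      refine ⟨subset_pyr v P hx, ?_⟩
      have := hp x hx 0
      simp only [sub_zero, one_smul, zero_smul, add_zero, hgx, sub_self, mul_zero] at this
      exact this
    · rintro ⟨hx, hgx⟩
      rcases (mem_pyr hP).1 hx with rfl | ⟨p, hpP, s, h0, h1, rfl⟩
      · rw [hv] at hgx; linarith
      · rw [hp p hpP] at hgx
        have h2 := mul_nonneg (sub_nonneg.2 h1.le) (sub_nonneg.2 (hd p hpP))
        obtain rfl : s = 0 := by linarith
        simp only [sub_zero, one_smul, zero_smul, add_zero]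
        exact ⟨hpP, by linarith⟩

theorem IsFace.pyr_pyr (h : IsHeight f c v P) (hP : Convex ℝ P) (hF : IsFace P F) :
    IsFace (pyr v P) (pyr v F) := by
  have hFc := hF.convex hP
  obtain ⟨g, d, hd, rfl⟩ := hF
  -- With this `t` the apex attains the minimum and so belongs to the face.
  set t := d - g v
  have hv : (g + t • f) v = d + t * c := by
    simp only [LinearMap.add_apply, LinearMap.smul_apply, smul_eq_mul, h.apex, t]
    ring
  have hp : ∀ p ∈ P, ∀ s : ℝ, (g + t • f) ((1 - s) • p + s • v) =
      d + t * c + (1 - s) * (g p - d) := fun p hp s => by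
    rw [map_add, map_smul, map_smul, hv, LinearMap.add_apply, LinearMap.smul_apply, h.base p hp]
    simp only [smul_eq_mul]
    ring
  refine ⟨g + t • f, d + t * c, fun x hx => ?_, ?_⟩
  · rcases (mem_pyr hP).1 hx with rfl | ⟨p, hpP, s, h0, h1, rfl⟩
    · rw [hv]
    · rw [hp p hpP]
      have := mul_nonneg (sub_nonneg.2 h1.le) (sub_nonneg.2 (hd p hpP))
      linarith
  · ext x
    constructor
    · intro hx
      refine ⟨pyr_mono v (fun y hy => hy.1) hx, ?_⟩
      rcases (mem_pyr hFc).1 hx with rfl | ⟨p, hpF, s, h0, h1, rfl⟩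
      · exact hv
      · rw [hp p hpF.1, hpF.2]
        ring
    · rintro ⟨hx, hgx⟩
      rw [mem_pyr hFc]
      rcases (mem_pyr hP).1 hx with rfl | ⟨p, hpP, s, h0, h1, rfl⟩
      · exact Or.inl rfl
      · rw [hp p hpP] at hgx
        have h2 : (1 - s) * (g p - d) = 0 := by linarith
        rcases mul_eq_zero.1 h2 with h3 | h3
        · linarith
        · exact Or.inr ⟨p, ⟨hpP, by linarith⟩, s, h0, h1, rfl⟩

theorem IsFace.inter_base (hG : IsFace (pyr v P) G) : IsFace P (G ∩ P) := by
  obtain ⟨g, d, hd, rfl⟩ := hG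
  refine ⟨g, d, fun x hx => hd x (subset_pyr v P hx), ?_⟩
  ext x
  constructor
  · rintro ⟨h1, h2⟩
    exact ⟨h2, h1.2⟩
  · rintro ⟨h1, h2⟩
    exact ⟨⟨subset_pyr v P h1, h2⟩, h1⟩

theorem IsFace.eq_of_apex_notMem (hP : Convex ℝ P) (hG : IsFace (pyr v P) G)
    (hv : v ∉ G) : G ∩ P = G := by
  obtain ⟨g, d, hd, rfl⟩ := hG
  have hgv : d < g v := lt_of_le_of_ne (hd v (apex_mem_pyr v P)) fun h =>
    hv ⟨apex_mem_pyr v P, h.symm⟩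
  refine Set.inter_eq_left.2 ?_
  rintro x ⟨hx, hgx⟩
  rcases (mem_pyr hP).1 hx with rfl | ⟨p, hpP, s, h0, h1, rfl⟩
  · exact absurd hgx hgv.ne'
  · simp only [map_add, map_smul, smul_eq_mul] at hgx
    have h2 := mul_nonneg (sub_nonneg.2 h1.le) (sub_nonneg.2 (hd p (subset_pyr v P hpP)))
    rcases h0.eq_or_lt with rfl | h0
    · simpa using hpP
    · have := mul_pos h0 (sub_pos.2 hgv)
      nlinarith

theorem IsFace.eq_of_apex_mem (hP : Convex ℝ P) (hG : IsFace (pyr v P) G)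
    (hv : v ∈ G) : pyr v (G ∩ P) = G := by
  refine Set.Subset.antisymm (convexHull_min ?_ (hG.convex (convex_pyr v P))) ?_
  · exact Set.insert_subset hv Set.inter_subset_left
  · intro x hxG
    have hGP := hG.inter_base.convex hP
    obtain ⟨g, d, hd, rfl⟩ := hG
    rw [mem_pyr hGP]
    rcases (mem_pyr hP).1 hxG.1 with rfl | ⟨p, hpP, s, h0, h1, rfl⟩
    · exact Or.inl rfl
    · have hgx := hxG.2
      simp only [map_add, map_smul, smul_eq_mul, hv.2] at hgx
      have h2 : (1 - s) * (g p - d) = 0 := by linarith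
      rcases mul_eq_zero.1 h2 with h3 | h3
      · linarith
      · exact Or.inr ⟨p, ⟨⟨subset_pyr v P hpP, by linarith⟩, hpP⟩, s, h0, h1, rfl⟩

/-- The faces of a pyramid: the faces of its base and the pyramids over these. -/
def pyrFace (v : V) (F : Set V) (b : Bool) : Set V := if b then pyr v F else F

theorem IsHeight.pyrFace_inter (h : IsHeight f c v P) (hF : F ⊆ P) (hFc : Convex ℝ F) (b : Bool) :
    pyrFace v F b ∩ P = F := by
  cases b
  · exact Set.inter_eq_left.2 hF
  · exact h.pyr_inter hF hFc

theorem IsHeight.apex_mem_pyrFace (h : IsHeight f c v P) (hF : F ⊆ P) (b : Bool) :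
    v ∈ pyrFace v F b ↔ b = true := by
  cases b
  · simpa [pyrFace] using fun hv => h.apex_notMem (hF hv)
  · simpa [pyrFace] using apex_mem_pyr v F

theorem IsFace.pyrFace (h : IsHeight f c v P) (hP : Convex ℝ P) (hF : IsFace P F) (b : Bool) :
    IsFace (pyr v P) (pyrFace v F b) := by
  cases b
  · exact hF.pyr_base h hP
  · exact hF.pyr_pyr h hP

open Classical in
/-- The face poset of a pyramid is the product of the one of its base and a two-element chain. -/
def IsHeight.faceIso (h : IsHeight f c v P) (hP : Convex ℝ P) :
    Face P × Bool ≃o Face (pyr v P) where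
  toFun F := ⟨StringyE.pyrFace v F.1.1 F.2, F.1.2.pyrFace h hP F.2⟩
  invFun G := (⟨G.1 ∩ P, G.2.inter_base⟩, decide (v ∈ G.1))
  left_inv := by
    rintro ⟨⟨F, hF⟩, b⟩
    refine Prod.ext (Subtype.ext (h.pyrFace_inter hF.subset (hF.convex hP) b)) ?_
    simp only [h.apex_mem_pyrFace hF.subset]
    simp
  right_inv := by
    rintro ⟨G, hG⟩
    apply Subtype.ext
    by_cases hv : v ∈ G
    · simpa [StringyE.pyrFace, hv] using hG.eq_of_apex_mem hP hv
    · simpa [StringyE.pyrFace, hv] using hG.eq_of_apex_notMem hP hv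
  map_rel_iff' := by
    rintro ⟨⟨F, hF⟩, a⟩ ⟨⟨G, hG⟩, b⟩
    change StringyE.pyrFace v F a ⊆ StringyE.pyrFace v G b ↔ _
    constructor
    · intro hs
      refine ⟨?_, ?_⟩
      · change F ⊆ G
        rw [← h.pyrFace_inter hF.subset (hF.convex hP) a,
          ← h.pyrFace_inter hG.subset (hG.convex hP) b]
        exact Set.inter_subset_inter_left P hs
      · change a ≤ b
        intro ha
        exact (h.apex_mem_pyrFace hG.subset b).1 (hs ((h.apex_mem_pyrFace hF.subset a).2 ha))
    · rintro ⟨h1, h2⟩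
      have h1 : F ⊆ G := h1
      have h2 : a ≤ b := h2
      cases a
      · cases b
        · exact h1
        · exact Set.Subset.trans h1 (subset_pyr v G)
      · obtain rfl : b = true := h2 rfl
        exact pyr_mono v h1

theorem IsHeight.faceIso_top (h : IsHeight f c v P) (hP : Convex ℝ P) :
    h.faceIso hP (⟨P, isFace_self P⟩, true) = ⟨pyr v P, isFace_self _⟩ := rfl

theorem dimSucc_mono [FiniteDimensional ℝ V] (h : F ⊆ P) : dimSucc F ≤ dimSucc P := by
  rw [dimSucc, dimSucc]
  split_ifs with h1 h2
  · exact Nat.add_le_add_right (Submodule.finrank_mono (vectorSpan_mono ℝ h)) 1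
  · exact absurd (h1.mono h) h2
  · exact Nat.zero_le _
  · exact le_rfl

theorem dimSucc_pyr [FiniteDimensional ℝ V] (h : IsHeight f c v P) :
    dimSucc (pyr v P) = dimSucc P + 1 := by
  rw [dimSucc, if_pos ⟨v, apex_mem_pyr v P⟩, dimSucc]
  rw [← direction_affineSpan, pyr, affineSpan_convexHull]
  split_ifs with hne
  · obtain ⟨p, hp⟩ := hne
    rw [← affineSpan_insert_affineSpan, AffineSubspace.direction_affineSpan_insert (mem_affineSpan ℝ hp),
      direction_affineSpan]
    have hker : vectorSpan ℝ P ≤ LinearMap.ker f := by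
      rw [vectorSpan_def, Submodule.span_le]
      rintro _ ⟨a, ha, b, hb, rfl⟩
      simp [h.base a ha, h.base b hb]
    have hfv : f (v - p) = 1 := by
      rw [map_sub, h.apex, h.base p hp]; ring
    have hdis : Submodule.span ℝ {v - p} ⊓ vectorSpan ℝ P = ⊥ := by
      rw [eq_bot_iff]
      rintro x ⟨hx1, hx2⟩
      obtain ⟨a, rfl⟩ := Submodule.mem_span_singleton.1 hx1
      have := hker hx2
      rw [LinearMap.mem_ker, map_smul, hfv, smul_eq_mul, mul_one] at this
      simp [this]
    have hd := Submodule.finrank_sup_add_finrank_inf_eq (Submodule.span ℝ {v - p}) (vectorSpan ℝ P)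
    rw [hdis, finrank_bot, add_zero, finrank_span_singleton (fun h0 => by simp [h0] at hfv)] at hd
    rw [vsub_eq_sub, hd, add_comm 1]
  · rw [Set.not_nonempty_iff_eq_empty.1 hne, insert_empty_eq, direction_affineSpan,
      vectorSpan_singleton, finrank_bot]

end Height

/-! ### Lattice points of pyramids, `h^*` and `S̃`. -/

section LatticePoints

variable {Λ : Submodule ℤ V} {f : Module.Dual ℝ V} {c : ℤ} {v : V} {P : Set V}

/-- This is where integral distance `1` enters: the height of a lattice point over the dilated base
is an integer. It is `0` on the base; otherwise it is at least `1`, and subtracting `v` leads to the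
previous dilate. -/
theorem smul_pyr_succ_inter (hΛ : f ∈ dualLattice Λ) (hvΛ : v ∈ Λ) (h : IsHeight f c v P)
    (hP : Convex ℝ P) (k : ℕ) :
    ((k + 1 : ℕ) : ℝ) • pyr v P ∩ (Λ : Set V) =
      (((k + 1 : ℕ) : ℝ) • P ∩ (Λ : Set V)) ∪ (fun x => v + x) '' ((k : ℝ) • pyr v P ∩ Λ) := by
  have hk0 : (0 : ℝ) ≤ k := Nat.cast_nonneg k
  have hk : (0 : ℝ) < (k : ℝ) + 1 := by positivity
  push_cast
  ext x
  constructor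
  · rintro ⟨⟨y, hy, rfl⟩, hx⟩
    dsimp only at hx ⊢
    rcases (mem_pyr hP).1 hy with rfl | ⟨p, hp, s, h0, h1, rfl⟩
    · refine Or.inr ⟨(k : ℝ) • y, ⟨Set.smul_mem_smul_set (apex_mem_pyr _ _), ?_⟩, ?_⟩
      · rw [← Nat.cast_smul_eq_nsmul ℝ k y |>.symm]
        exact Λ.nsmul_mem hvΛ k
      · module
    · obtain ⟨z, hz⟩ := hΛ _ hx
      rw [map_smul, h.apply_comb hp, smul_eq_mul] at hz
      obtain ⟨n, hn⟩ : ∃ n : ℤ, ((k : ℝ) + 1) * s = n :=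
        ⟨z - (k + 1) * c, by push_cast; linarith⟩
      rcases h0.eq_or_lt with rfl | h0
      · left
        refine ⟨?_, hx⟩
        simpa using Set.smul_mem_smul_set hp
      · right
        have hn0 : (0 : ℝ) < n := hn ▸ mul_pos hk h0
        have hn1 : (1 : ℝ) ≤ n := by exact_mod_cast hn0
        have hnk : (n : ℝ) < k + 1 := by
          rw [← hn]; nlinarith
        have hkpos : (0 : ℝ) < k := by
          have h2 : n < (k : ℤ) + 1 := by exact_mod_cast hnk
          have h3 : (1 : ℤ) ≤ n := by exact_mod_cast hn1
          have : (0 : ℤ) < k := by omega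
          exact_mod_cast this
        refine ⟨(((k : ℝ) + 1) • ((1 - s) • p + s • v)) - v, ⟨?_, Λ.sub_mem hx hvΛ⟩, by simp⟩
        -- Subtracting `v` lowers the height from `n` to `n - 1`, out of a maximal height `k` in the
        -- `k`-th dilate.
        refine ⟨(1 - (n - 1) / k : ℝ) • p + ((n - 1) / k : ℝ) • v, ?_, ?_⟩
        · refine convex_pyr v P (subset_pyr v P hp) (apex_mem_pyr v P) ?_ ?_ (by ring)
          · rw [sub_nonneg, div_le_one hkpos]; linarith
          · exact div_nonneg (by linarith) hk0
        · have e1 : (k : ℝ) * (1 - (n - 1) / k) = ((k : ℝ) + 1) * (1 - s) := by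
            field_simp
            linarith
          have e2 : (k : ℝ) * ((n - 1) / k) = ((k : ℝ) + 1) * s - 1 := by
            field_simp
            linarith
          dsimp only
          rw [smul_add, smul_smul, smul_smul, e1, e2]
          module
  · rintro (⟨⟨p, hp, rfl⟩, hx⟩ | ⟨_, ⟨⟨z, hz, rfl⟩, hx⟩, rfl⟩)
    · exact ⟨Set.smul_mem_smul_set (subset_pyr v P hp), hx⟩
    · refine ⟨⟨(1 / ((k : ℝ) + 1)) • v + ((k : ℝ) / (k + 1)) • z, ?_, ?_⟩, Λ.add_mem hvΛ hx⟩
      · refine convex_pyr v P (apex_mem_pyr v P) hz (by positivity) (by positivity) ?_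
        field_simp
        ring
      · dsimp only
        rw [smul_add, smul_smul, smul_smul, mul_one_div_cancel hk.ne', mul_div_cancel₀ _ hk.ne',
          one_smul]

theorem finite_smul_pyr_inter (hΛ : f ∈ dualLattice Λ) (hvΛ : v ∈ Λ) (h : IsHeight f c v P)
    (hP : Convex ℝ P) (hfin : ∀ k : ℕ, ((k : ℝ) • P ∩ (Λ : Set V)).Finite) (k : ℕ) :
    ((k : ℝ) • pyr v P ∩ (Λ : Set V)).Finite := by
  induction k with
  | zero =>
    rw [Nat.cast_zero, Set.zero_smul_set ⟨v, apex_mem_pyr v P⟩]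
    exact (Set.finite_singleton (0 : V)).inter_of_left _
  | succ k ih =>
    rw [smul_pyr_succ_inter hΛ hvΛ h hP]
    exact (hfin _).union (ih.image _)

theorem ncard_smul_pyr_succ (hΛ : f ∈ dualLattice Λ) (hvΛ : v ∈ Λ) (h : IsHeight f c v P)
    (hP : Convex ℝ P) (hfin : ∀ k : ℕ, ((k : ℝ) • P ∩ (Λ : Set V)).Finite) (k : ℕ) :
    (((k + 1 : ℕ) : ℝ) • pyr v P ∩ (Λ : Set V)).ncard =
      (((k + 1 : ℕ) : ℝ) • P ∩ (Λ : Set V)).ncard + ((k : ℝ) • pyr v P ∩ (Λ : Set V)).ncard := by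
  rw [smul_pyr_succ_inter hΛ hvΛ h hP, Set.ncard_union_eq _ (hfin _)
    ((finite_smul_pyr_inter hΛ hvΛ h hP hfin k).image _),
    Set.ncard_image_of_injective _ (add_right_injective v)]
  rw [Set.disjoint_left]
  rintro _ ⟨⟨p, hp, rfl⟩, -⟩ ⟨_, ⟨⟨z, hz, rfl⟩, -⟩, hx⟩
  -- The form `f` separates the two parts: it is `(k + 1) * c` on the first and at least `(k + 1) *
  -- c + 1` on the second.
  have h1 := congrArg f hx
  simp only [map_add, map_smul, smul_eq_mul, h.apex, h.base p hp] at h1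
  have h2 := mul_le_mul_of_nonneg_left (h.le_apply hP hz) (Nat.cast_nonneg (α := ℝ) k)
  push_cast at h1
  linarith

/-- By the recursion for the point counts, multiplying the series of the pyramid by `1 - t` gives
that of the base. The constant term needs a nonempty base: the zeroth dilate of the empty set is
empty. -/
theorem ehrhartNumerator_pyr [FiniteDimensional ℝ V] (hΛ : f ∈ dualLattice Λ) (hvΛ : v ∈ Λ)
    (h : IsHeight f c v P) (hP : Convex ℝ P)
    (hfin : ∀ k : ℕ, ((k : ℝ) • P ∩ (Λ : Set V)).Finite) (hne : P.Nonempty) :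
    ehrhartNumerator Λ (pyr v P) = ehrhartNumerator Λ P := by
  rw [ehrhartNumerator, ehrhartNumerator, dimSucc_pyr h, pow_succ, mul_assoc]
  congr 1
  ext k
  rw [sub_mul, one_mul, map_sub]
  cases k with
  | zero =>
    rw [PowerSeries.coeff_zero_X_mul]
    simp [Set.zero_smul_set hne, Set.zero_smul_set (⟨v, apex_mem_pyr v P⟩ : (pyr v P).Nonempty)]
  | succ k =>
    rw [PowerSeries.coeff_succ_X_mul, PowerSeries.coeff_mk, PowerSeries.coeff_mk,
      PowerSeries.coeff_mk, ncard_smul_pyr_succ hΛ hvΛ h hP hfin]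
    push_cast
    ring

theorem hStar_singleton (hvΛ : v ∈ Λ) : hStar Λ {v} = 1 := by
  have hE : ehrhartNumerator Λ {v} = 1 := by
    have hd : dimSucc ({v} : Set V) = 1 := by simp [dimSucc]
    rw [ehrhartNumerator, hd, pow_one, mul_comm]
    refine Eq.trans (congrArg (· * (1 - PowerSeries.X)) ?_)
      (PowerSeries.mk_one_mul_one_sub_eq_one ℤ)
    ext k
    have hk : (k : ℝ) • v ∈ Λ := by
      rw [Nat.cast_smul_eq_nsmul]
      exact Λ.nsmul_mem hvΛ k
    rw [PowerSeries.coeff_mk, Set.smul_set_singleton, Set.inter_eq_left.2 (Set.singleton_subset_iff.2 hk)]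
    simp
  have hex : ∃ p : ℤ[X], (p : PowerSeries ℤ) = ehrhartNumerator Λ {v} := ⟨1, by simp [hE]⟩
  rw [hStar, if_neg (Set.singleton_ne_empty v), dif_pos hex]
  apply Polynomial.coe_injective
  rw [hex.choose_spec, hE, Polynomial.coe_one]

/-- The `h^*`-polynomial of a lattice pyramid is the one of its base. -/
theorem hStar_pyr [FiniteDimensional ℝ V] (hΛ : f ∈ dualLattice Λ) (hvΛ : v ∈ Λ)
    (h : IsHeight f c v P) (hP : Convex ℝ P)
    (hfin : ∀ k : ℕ, ((k : ℝ) • P ∩ (Λ : Set V)).Finite) : hStar Λ (pyr v P) = hStar Λ P := by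
  rcases P.eq_empty_or_nonempty with rfl | hne
  · have : pyr v (∅ : Set V) = {v} := by simp [pyr]
    rw [this, hStar_singleton hvΛ, hStar, if_pos rfl]
  · have hne' : pyr v P ≠ ∅ := Set.Nonempty.ne_empty ⟨v, apex_mem_pyr v P⟩
    rw [hStar, hStar, if_neg hne', if_neg hne.ne_empty]
    -- Both sides choose a polynomial for the same power series, so its existence plays no role.
    congr! 2
    all_goals simp only [ehrhartNumerator_pyr hΛ hvΛ h hP hfin hne]

/-- The `S̃`-polynomial of a lattice pyramid vanishes. -/
theorem sTilde_pyr [FiniteDimensional ℝ V] (hΛ : f ∈ dualLattice Λ) (hvΛ : v ∈ Λ)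
    (h : IsHeight f c v P) (hP : Convex ℝ P)
    (hfin : ∀ k : ℕ, ((k : ℝ) • P ∩ (Λ : Set V)).Finite) : sTilde Λ (pyr v P) = 0 := by
  classical
  rw [sTilde]
  split_ifs with hF
  swap
  · rfl
  let e := h.faceIso hP
  have : Finite (Face P × Bool) := Finite.of_equiv _ e.symm.toEquiv
  have : Finite (Face P) := Finite.of_injective (fun F : Face P => (F, true))
    fun _ _ h => congrArg Prod.fst h
  have := Fintype.ofFinite (Face P)
  rw [← finsum_comp_equiv e.toEquiv, finsum_eq_sum_of_fintype, Fintype.sum_prod_type]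
  -- The two terms over a fixed face `F` of the base cancel.
  refine Finset.sum_eq_zero fun F _ => ?_
  have hFP : F ≤ (⟨P, isFace_self P⟩ : Face P) := F.2.subset
  have hg : ∀ b : Bool, gPoly (e (F, b)) (⟨pyr v P, isFace_self _⟩ : Face (pyr v P)) =
      gPoly F (⟨P, isFace_self P⟩ : Face P) := fun b => by
    rw [← h.faceIso_top hP, gPoly_orderIso e ⟨hFP, Bool.le_true b⟩]
    cases b
    · exact gPoly_false_true F hFP
    · exact gPoly_level true hFP
  have hF' := h.mono F.2.subset
  have hd := dimSucc_mono F.2.subset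
  rw [Fintype.sum_bool]
  simp only [RelIso.coe_fn_toEquiv, hg]
  have e1 : (e (F, true)).1 = pyr v F.1 := rfl
  have e2 : (e (F, false)).1 = F.1 := rfl
  rw [e1, e2, hStar_pyr hΛ hvΛ hF' (F.2.convex hP) fun k =>
    (hfin k).subset (Set.inter_subset_inter_left _ (Set.smul_set_mono F.2.subset)),
    dimSucc_pyr h, dimSucc_pyr hF', Nat.add_sub_add_right, Nat.sub_add_comm hd, pow_succ]
  ring

end LatticePoints

end Pyramids

/-! ### The dual grading of a Gorenstein polytope. -/

section Duality

/-- A substitute for discreteness, applied to the dual lattice: integral, bounded coordinates take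
finitely many values. -/
theorem finite_of_bounded_of_integral {V ι : Type*} [AddCommGroup V] [Module ℝ V] [Finite ι]
    (b : ι → Module.Dual ℝ V) (hinj : ∀ x, (∀ i, b i x = 0) → x = 0) {A : Set V}
    (hint : ∀ x ∈ A, ∀ i, ∃ k : ℤ, b i x = k) (hbdd : ∀ i, ∃ C : ℝ, ∀ x ∈ A, |b i x| ≤ C) :
    A.Finite := by
  choose C hC using hbdd
  let φ : V → ι → ℤ := fun x i => ⌊b i x⌋
  refine Set.Finite.of_finite_image (f := φ) ?_ ?_
  · refine (Set.Finite.pi' (t := fun i => Set.Icc (⌊-C i⌋) ⌊C i⌋)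
      fun i => Set.finite_Icc _ _).subset ?_
    rintro _ ⟨x, hx, rfl⟩ i
    have := abs_le.1 (hC i x hx)
    exact ⟨Int.floor_mono this.1, Int.floor_mono this.2⟩
  · intro x hx y hy hxy
    refine sub_eq_zero.1 (hinj _ fun i => ?_)
    obtain ⟨k, hk⟩ := hint x hx i
    obtain ⟨l, hl⟩ := hint y hy i
    have h := congrFun hxy i
    simp only [φ, hk, hl, Int.floor_intCast] at h
    rw [map_sub, hk, hl, h, sub_self]

theorem mk_one_mem_liftLattice {E : Type*} [NormedAddCommGroup E] {L : Submodule ℤ E}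
    {x : E} (hx : x ∈ L) : (x, (1 : ℝ)) ∈ liftLattice L :=
  ⟨hx, Submodule.mem_span_singleton_self _⟩

theorem mem_liftLattice {E : Type*} [NormedAddCommGroup E] {L : Submodule ℤ E} {x : E} {t : ℝ} :
    (x, t) ∈ liftLattice L ↔ x ∈ L ∧ ∃ n : ℤ, t = n := by
  rw [liftLattice, Submodule.mem_prod, Submodule.mem_span_singleton]
  refine and_congr_right fun _ => exists_congr fun n => ?_
  rw [zsmul_one, eq_comm]

variable {E : Type*} [NormedAddCommGroup E] [NormedSpace ℝ E] {L : Submodule ℤ E} {Δ : Set E}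

/-- The linear form `(x, t) ↦ f x + a t`. -/
def affForm (f : Module.Dual ℝ E) (a : ℝ) : Module.Dual ℝ (E × ℝ) :=
  f.comp (LinearMap.fst ℝ E ℝ) + a • LinearMap.snd ℝ E ℝ

theorem affForm_apply (f : Module.Dual ℝ E) (a : ℝ) (x : E) (t : ℝ) :
    affForm f a (x, t) = f x + a * t := by
  simp [affForm]

theorem eq_affForm (y : Module.Dual ℝ (E × ℝ)) :
    y = affForm (y.comp (LinearMap.inl ℝ E ℝ)) (y (0, 1)) := by
  refine LinearMap.ext fun ⟨x, t⟩ => ?_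
  have : ((x, t) : E × ℝ) = (x, 0) + t • (0, 1) := by simp
  rw [affForm_apply, this, map_add, map_smul, smul_eq_mul, mul_comm]
  rfl

theorem mem_dualCone {y : Module.Dual ℝ (E × ℝ)} :
    y ∈ dualCone Δ ↔ ∀ x ∈ Δ, 0 ≤ y (x, 1) := by
  rw [dualCone, coneOver, PointedCone.dual_hull, PointedCone.mem_dual]
  constructor
  · intro h x hx
    exact h (Set.mk_mem_prod hx rfl)
  · rintro h ⟨x, t⟩ ⟨hx, ht⟩
    obtain rfl : t = 1 := ht
    exact h x hx

theorem affForm_mem_dualLattice {f : Module.Dual ℝ E} (hf : f ∈ dualLattice L) (a : ℤ) :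
    affForm f a ∈ dualLattice (liftLattice L) := by
  rintro ⟨x, t⟩ hx
  obtain ⟨hxL, n, rfl⟩ := mem_liftLattice.1 hx
  obtain ⟨k, hk⟩ := hf x hxL
  exact ⟨k + a * n, by rw [affForm_apply, hk]; push_cast; ring⟩

theorem eval_mem_dualLattice {V : Type*} [AddCommGroup V] [Module ℝ V] {Λ : Submodule ℤ V} {x : V}
    (hx : x ∈ Λ) : Module.Dual.eval ℝ V x ∈ dualLattice (dualLattice Λ) :=
  fun _ hy => hy x hx

section Reflexive

variable {R : Set E}

theorem exists_smul_mem_of_zero_mem_interior (hR : (0 : E) ∈ interior R) (z : E) :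
    ∃ ε : ℝ, 0 < ε ∧ ε • z ∈ R := by
  have hc : Filter.Tendsto (fun ε : ℝ => ε • z) (nhdsWithin 0 (Set.Ioi 0)) (nhds 0) := by
    have : Filter.Tendsto (fun ε : ℝ => ε • z) (nhds 0) (nhds ((0 : ℝ) • z)) :=
      (continuous_id.smul continuous_const).tendsto 0
    rw [zero_smul] at this
    exact this.mono_left nhdsWithin_le_nhds
  have h1 := hc.eventually (mem_interior_iff_mem_nhds.1 hR)
  obtain ⟨ε, h2, h3⟩ := (h1.and self_mem_nhdsWithin).exists
  exact ⟨ε, h3, h2⟩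

theorem eq_zero_of_nonneg_of_zero_mem_interior (hR : (0 : E) ∈ interior R) {f : Module.Dual ℝ E}
    (hf : ∀ x ∈ R, 0 ≤ f x) : f = 0 := by
  have h : ∀ z, 0 ≤ f z := fun z => by
    obtain ⟨ε, h1, h2⟩ := exists_smul_mem_of_zero_mem_interior hR z
    have := hf _ h2
    rw [map_smul, smul_eq_mul] at this
    exact nonneg_of_mul_nonneg_right this h1
  refine LinearMap.ext fun z => le_antisymm ?_ (h z)
  have := h (-z)
  rw [map_neg] at this
  simpa using this

/-- The polar dual contains `±ε g` for some `g ≠ 0`. Each of its nonzero points is a positive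
multiple of a point of the hull of `s \ {0}`, so that hull meets two opposite rays and contains `0`
by convexity. -/
theorem zero_mem_convexHull_diff [FiniteDimensional ℝ E] [Nontrivial E] (hR : IsCompact R)
    {s : Set (Module.Dual ℝ E)} (hs : polarDual R = convexHull ℝ s) :
    (0 : Module.Dual ℝ E) ∈ convexHull ℝ (s \ {0}) := by
  obtain ⟨g, hg⟩ := exists_ne (0 : Module.Dual ℝ E)
  obtain ⟨B, hB⟩ := hR.exists_bound_of_continuousOn (f := g)
    (LinearMap.continuous_of_finiteDimensional g).continuousOn
  set ε : ℝ := 1 / (|B| + 1)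
  have hε : 0 < ε := by positivity
  have hεB : ∀ x ∈ R, |ε * g x| ≤ 1 := fun x hx => by
    rw [abs_mul, abs_of_pos hε, one_div_mul_eq_div, div_le_one (by positivity)]
    have := hB x hx
    rw [Real.norm_eq_abs] at this
    linarith [le_abs_self B]
  have key : ∀ h ∈ polarDual R, h ≠ 0 → ∃ q ∈ convexHull ℝ (s \ {0}), ∃ b : ℝ, 0 < b ∧
      h = b • q := by
    intro h hh h0
    have hsub : s ⊆ insert 0 (s \ {0}) := fun x hx => by
      by_cases hx0 : x = 0
      · exact Or.inl hx0
      · exact Or.inr ⟨hx, hx0⟩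
    have h1 : h ∈ pyr 0 (convexHull ℝ (s \ {0})) := by
      rw [hs] at hh
      exact convexHull_mono (hsub.trans (Set.insert_subset_insert (subset_convexHull ℝ _))) hh
    rcases (mem_pyr (convex_convexHull ℝ _)).1 h1 with h2 | ⟨q, hq, σ, -, hσ, h2⟩
    · exact absurd h2 h0
    · exact ⟨q, hq, 1 - σ, sub_pos.2 hσ, by simpa using h2⟩
  obtain ⟨q, hq, b, hb, h1⟩ := key (ε • g)
    (fun x hx => by simpa using (abs_le.1 (hεB x hx)).1) (smul_ne_zero hε.ne' hg)
  obtain ⟨q', hq', b', hb', h2⟩ := key (-(ε • g))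
    (fun x hx => by simpa using (abs_le.1 (hεB x hx)).2) (neg_ne_zero.2 (smul_ne_zero hε.ne' hg))
  have h3 : (0 : Module.Dual ℝ E) = (b / (b + b')) • q + (b' / (b + b')) • q' := by
    rw [div_eq_inv_mul, div_eq_inv_mul, mul_smul, mul_smul, ← smul_add, ← h1, ← h2, add_neg_cancel,
      smul_zero]
  have h4 : b / (b + b') + b' / (b + b') = 1 := by field_simp
  have h5 := convex_convexHull ℝ _ hq hq' (by positivity) (by positivity) h4
  rwa [← h3] at h5

theorem convexHull_diff_zero [FiniteDimensional ℝ E] [Nontrivial E] (hR : IsCompact R)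
    {s : Set (Module.Dual ℝ E)} (hs : polarDual R = convexHull ℝ s) :
    polarDual R = convexHull ℝ (s \ {0}) := by
  rw [hs]
  refine Set.Subset.antisymm (convexHull_min (fun x hx => ?_) (convex_convexHull ℝ _))
    (convexHull_mono Set.sdiff_subset)
  by_cases hx0 : x = 0
  · rw [hx0]
    exact zero_mem_convexHull_diff hR hs
  · exact subset_convexHull ℝ _ ⟨hx, hx0⟩

end Reflexive

/-- The grading is `(m, r)`. A form `f` in the polar dual of `r Δ - m` lifts to the form `A f` with
linear part `f` and value `1` at `(m, r)`, and the nonzero generators of the polar dual lift to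
generators of the dual cone. -/
theorem IsGorenstein.exists_isDualGrading [FiniteDimensional ℝ E] {r : ℕ}
    (hΔ : IsGorenstein L Δ r) : ∃ m, IsDualGrading L Δ m := by
  obtain ⟨hr, ⟨t, htfin, htL, rfl⟩, m, hmL, -, -, h0, s, hsfin, hsL, hs⟩ := hΔ
  set Δ := convexHull ℝ t with hΔdef
  set R := (fun x => x - m) '' ((r : ℝ) • Δ) with hRdef
  have hr' : (0 : ℝ) < r := by exact_mod_cast hr
  have hmem : ∀ x ∈ Δ, (r : ℝ) • x - m ∈ R := fun x hx =>
    ⟨_, Set.smul_mem_smul_set hx, rfl⟩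
  have hofmem : ∀ z ∈ R, ∃ x ∈ Δ, z = (r : ℝ) • x - m := by
    rintro _ ⟨_, ⟨x, hx, rfl⟩, rfl⟩
    exact ⟨x, hx, rfl⟩
  -- In dimension `0` the polar dual is `{0}` and no nonzero generator exists; the dual cone is a
  -- ray and the grading is `(0, 1)`.
  rcases subsingleton_or_nontrivial E with hE | hE
  · refine ⟨(0, 1), mem_liftLattice.2 ⟨L.zero_mem, 1, by simp⟩, {affForm 0 (1 : ℤ)},
      Set.finite_singleton _, ?_, ?_, ?_⟩
    · rw [Set.singleton_subset_iff]
      exact affForm_mem_dualLattice (Submodule.zero_mem _) 1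
    · rintro _ rfl
      simp [affForm_apply]
    · apply le_antisymm
      · intro y hy
        obtain ⟨x, hx, -⟩ := hofmem _ (interior_subset h0)
        have hpos := mem_dualCone.1 hy x hx
        rw [Subsingleton.elim x 0] at hpos
        have hy' : y = y (0, 1) • affForm 0 ((1 : ℤ) : ℝ) := by
          refine LinearMap.ext fun ⟨z, u⟩ => ?_
          rw [Subsingleton.elim z 0]
          have : ((0, u) : E × ℝ) = u • (0, 1) := by simp
          rw [this, map_smul, LinearMap.smul_apply, map_smul, affForm_apply]
          simp [mul_comm]
        rw [hy']
        exact PointedCone.smul_mem _ hpos (PointedCone.subset_hull rfl)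
      · refine Submodule.span_le.2 (Set.singleton_subset_iff.2 (mem_dualCone.2 fun x _ => ?_))
        simp [affForm_apply]
  have hRc : IsCompact R :=
    ((htfin.isCompact_convexHull (𝕜 := ℝ)).smul (r : ℝ)).image (continuous_id.sub continuous_const)
  -- A generator `0` has to be discarded, since its lift has the coefficient `1 / r`, in general not
  -- an integer.
  have hP := convexHull_diff_zero hRc hs
  let A : Module.Dual ℝ E → Module.Dual ℝ (E × ℝ) := fun f => affForm f ((1 - f m) / r)
  refine ⟨(m, (r : ℝ)), mem_liftLattice.2 ⟨hmL, r, by simp⟩, A '' (s \ {0}),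
    (hsfin.subset Set.sdiff_subset).image _, ?_, ?_, ?_⟩
  · rintro _ ⟨f, ⟨hfs, hf0⟩, rfl⟩
    have hfP : ∀ z ∈ R, -1 ≤ f z := by
      have : f ∈ polarDual R := hs ▸ subset_convexHull ℝ s hfs
      exact this
    obtain ⟨x, hxt, hx⟩ : ∃ x ∈ t, f ((r : ℝ) • x - m) < 0 := by
      by_contra! hcon
      refine hf0 (eq_zero_of_nonneg_of_zero_mem_interior h0 fun z hz => ?_)
      obtain ⟨x, hx, rfl⟩ := hofmem z hz
      have hconv : Convex ℝ {x : E | f m / r ≤ f x} := convex_halfSpace_ge f.isLinear _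
      have hxm := convexHull_min (fun x hx => ?_) hconv hx
      · have : f m / r ≤ f x := hxm
        rw [div_le_iff₀ hr'] at this
        rw [map_sub, map_smul, smul_eq_mul]
        linarith
      · have := hcon x hx
        rw [map_sub, map_smul, smul_eq_mul] at this
        change f m / r ≤ f x
        rw [div_le_iff₀ hr']
        linarith
    have hx1 := hfP _ (hmem x (subset_convexHull ℝ t hxt))
    rw [map_sub, map_smul, smul_eq_mul] at hx hx1
    obtain ⟨a, ha⟩ := hsL hfs x (htL hxt)
    obtain ⟨b, hb⟩ := hsL hfs m hmL
    rw [ha, hb] at hx hx1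
    have hx' : (r : ℤ) * a - b < 0 := by exact_mod_cast hx
    have hx1' : -1 ≤ (r : ℤ) * a - b := by exact_mod_cast hx1
    -- The value at a lattice generator is a negative integer that is at least `-1`. Hence `(1 - f
    -- m) / r = -f x` is an integer.
    have hab : (r : ℤ) * a - b = -1 := by omega
    have hab' : (r : ℝ) * a - b = -1 := by exact_mod_cast hab
    have hA : A f = affForm f ((-a : ℤ) : ℝ) := by
      simp only [A, hb]
      congr 1
      rw [div_eq_iff hr'.ne']
      push_cast
      linarith
    rw [hA]
    exact affForm_mem_dualLattice (hsL hfs) _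
  · rintro _ ⟨f, -, rfl⟩
    simp only [A, affForm_apply]
    field_simp
    ring
  · apply le_antisymm
    · intro y hy
      obtain ⟨f, a, rfl⟩ : ∃ f a, y = affForm f a := ⟨_, _, eq_affForm y⟩
      have hfa : ∀ z ∈ R, 0 ≤ f z + (f m + a * r) := by
        intro z hz
        obtain ⟨x, hx, rfl⟩ := hofmem z hz
        have := mem_dualCone.1 hy x hx
        rw [affForm_apply] at this
        rw [map_sub, map_smul, smul_eq_mul]
        nlinarith
      -- The degree `u` of the form is nonnegative. Degree `0` forces the form to vanish; for `u >
      -- 0` it is `u` times the lift of `u⁻¹ • f`.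
      have hu := hfa 0 (interior_subset h0)
      rw [map_zero, zero_add] at hu
      rcases hu.eq_or_lt with hu | hu
      · rw [← hu] at hfa
        have hf0 : f = 0 := eq_zero_of_nonneg_of_zero_mem_interior h0 fun z hz => by
          simpa using hfa z hz
        rw [hf0, LinearMap.zero_apply, zero_add] at hu
        have ha : a = 0 := (mul_eq_zero.1 hu.symm).resolve_right hr'.ne'
        have : affForm f a = 0 := by simp [affForm, hf0, ha]
        rw [this]
        exact Submodule.zero_mem _
      · set u := f m + a * r with hudef
        have hAconv : convexHull ℝ (s \ {0}) ⊆ {h | A h ∈ PointedCone.hull ℝ (A '' (s \ {0}))} := by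
          refine convexHull_min (fun h hh => PointedCone.subset_hull ⟨h, hh, rfl⟩) ?_
          intro h hh h' hh' α β hα hβ hαβ
          have : A (α • h + β • h') = α • A h + β • A h' := by
            refine LinearMap.ext fun ⟨x, τ⟩ => ?_
            simp only [A, affForm_apply, LinearMap.add_apply, LinearMap.smul_apply, smul_eq_mul]
            field_simp
            linear_combination (-τ) * hαβ
          change A (α • h + β • h') ∈ PointedCone.hull ℝ (A '' (s \ {0}))
          rw [this]
          exact Submodule.add_mem _ (PointedCone.smul_mem _ hα hh) (PointedCone.smul_mem _ hβ hh')
        have hfu : u⁻¹ • f ∈ polarDual R := fun z hz => by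
          have := hfa z hz
          rw [LinearMap.smul_apply, smul_eq_mul, ← sub_nonneg]
          have h1 : u⁻¹ * f z - -1 = u⁻¹ * (f z + u) := by field_simp; ring
          rw [h1]
          exact mul_nonneg (inv_nonneg.2 hu.le) this
        have hAu : affForm f a = u • A (u⁻¹ • f) := by
          refine LinearMap.ext fun ⟨x, τ⟩ => ?_
          simp only [A, affForm_apply, LinearMap.smul_apply, smul_eq_mul]
          field_simp
          rw [hudef]
          ring
        rw [hAu]
        exact PointedCone.smul_mem _ hu.le (hAconv (hP ▸ hfu))
    · refine Submodule.span_le.2 ?_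
      rintro _ ⟨f, ⟨hfs, -⟩, rfl⟩
      refine mem_dualCone.2 fun x hx => ?_
      have hfP : f ∈ polarDual R := hs ▸ subset_convexHull ℝ s hfs
      have := hfP _ (hmem x hx)
      rw [map_sub, map_smul, smul_eq_mul] at this
      simp only [A, affForm_apply]
      rw [mul_one, ← mul_le_mul_iff_right₀ hr', mul_zero, mul_add, mul_div_cancel₀ _ hr'.ne']
      linarith

namespace IsDualGrading

variable {m m' : E × ℝ}

theorem induction (hm : IsDualGrading L Δ m) {p : Module.Dual ℝ (E × ℝ) → Prop}
    (hgen : ∀ y ∈ dualCone Δ, y ∈ dualLattice (liftLattice L) → y m = 1 → p y) (hzero : p 0)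
    (hadd : ∀ y z, p y → p z → p (y + z)) (hsmul : ∀ (a : ℝ) y, 0 ≤ a → p y → p (a • y))
    {y : Module.Dual ℝ (E × ℝ)} (hy : y ∈ dualCone Δ) : p y := by
  obtain ⟨-, S, -, hSL, hS1, hS⟩ := hm
  have hsub : S ⊆ dualCone Δ := by
    rw [hS]
    exact PointedCone.subset_hull
  rw [hS] at hy
  refine Submodule.span_induction (fun z hz => hgen z (hsub hz) (hSL hz) (hS1 z hz)) hzero
    (fun y z _ _ => hadd y z) (fun a y _ => hsmul a y a.2) hy

theorem nonneg_and_eq_zero (hm : IsDualGrading L Δ m) {y : Module.Dual ℝ (E × ℝ)}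
    (hy : y ∈ dualCone Δ) : 0 ≤ y m ∧ (y m = 0 → y = 0) := by
  refine hm.induction (p := fun y => 0 ≤ y m ∧ (y m = 0 → y = 0)) ?_ ?_ ?_ ?_ hy
  · intro y _ _ h
    rw [h]
    exact ⟨zero_le_one, fun h => absurd h one_ne_zero⟩
  · exact ⟨le_rfl, fun _ => rfl⟩
  · rintro y z ⟨h1, h2⟩ ⟨h3, h4⟩
    rw [LinearMap.add_apply]
    refine ⟨add_nonneg h1 h3, fun h => ?_⟩
    rw [h2 (by linarith), h4 (by linarith), add_zero]
  · rintro a y ha ⟨h1, h2⟩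
    rw [LinearMap.smul_apply, smul_eq_mul]
    refine ⟨mul_nonneg ha h1, fun h => ?_⟩
    rcases mul_eq_zero.1 h with h | h
    · rw [h, zero_smul]
    · rw [h2 h, smul_zero]

theorem one_le (hm : IsDualGrading L Δ m) {y : Module.Dual ℝ (E × ℝ)} (hy : y ∈ dualCone Δ)
    (hyL : y ∈ dualLattice (liftLattice L)) (h0 : y ≠ 0) : 1 ≤ y m := by
  obtain ⟨k, hk⟩ := hyL m hm.1
  obtain ⟨h1, h2⟩ := hm.nonneg_and_eq_zero hy
  have h3 : 0 < y m := lt_of_le_of_ne h1 fun h => h0 (h2 h.symm)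
  rw [hk] at h3 ⊢
  exact_mod_cast h3

/-- A generator has degree `1` for `m`, and as a nonzero lattice point of the cone it has degree at
least `1` for `m'`. -/
theorem apply_le (hm : IsDualGrading L Δ m) (hm' : IsDualGrading L Δ m')
    {y : Module.Dual ℝ (E × ℝ)} (hy : y ∈ dualCone Δ) : y m ≤ y m' := by
  refine hm.induction (p := fun y => y m ≤ y m') ?_ ?_ ?_ ?_ hy
  · intro y hy hyL h
    rw [h]
    refine hm'.one_le hy hyL ?_
    rintro rfl
    simp at h
  · exact le_rfl
  · intro y z h1 h2
    exact add_le_add h1 h2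
  · intro a y ha h
    exact mul_le_mul_of_nonneg_left h ha

/-- By symmetry of `apply_le`, any two gradings agree on the dual cone, so a single one can be
fixed. -/
theorem mem_dualPolytope (hm : IsDualGrading L Δ m) {y : Module.Dual ℝ (E × ℝ)} :
    y ∈ dualPolytope L Δ ↔ y ∈ dualCone Δ ∧ y m = 1 := by
  refine and_congr_right fun hy => ⟨?_, fun h => ⟨m, hm, h⟩⟩
  rintro ⟨m', hm', h⟩
  rw [← h]
  exact le_antisymm (hm.apply_le hm' hy) (hm'.apply_le hm hy)

theorem exists_abs_le (hm : IsDualGrading L Δ m) (x : E × ℝ) :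
    ∃ C : ℝ, ∀ y ∈ dualCone Δ, |y x| ≤ C * y m := by
  obtain ⟨-, S, hSfin, -, hS1, hS⟩ := hm
  obtain ⟨C, hC⟩ := (hSfin.image fun y => |y x|).bddAbove
  refine ⟨C, fun y hy => ?_⟩
  rw [hS] at hy
  refine Submodule.span_induction (p := fun y _ => |y x| ≤ C * y m) (fun z hz => ?_) ?_
    (fun y z _ _ h1 h2 => ?_) (fun a y _ h => ?_) hy
  · rw [hS1 z hz, mul_one]
    exact hC ⟨z, hz, rfl⟩
  · simp
  · rw [LinearMap.add_apply, LinearMap.add_apply, mul_add]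
    exact (abs_add_le _ _).trans (add_le_add h1 h2)
  · change |(a : ℝ) * y x| ≤ C * ((a : ℝ) * y m)
    rw [abs_mul, abs_of_nonneg a.2, mul_left_comm]
    exact mul_le_mul_of_nonneg_left h a.2

theorem finite_smul_inter [FiniteDimensional ℝ E] [DiscreteTopology L] [IsZLattice ℝ L]
    (hm : IsDualGrading L Δ m) (k : ℕ) :
    ((k : ℝ) • dualPolytope L Δ ∩ (dualLattice (liftLattice L) : Set _)).Finite := by
  have : Module.Finite ℤ L := ZLattice.module_finite ℝ L
  have : Module.Free ℤ L := ZLattice.module_free ℝ L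
  let b := Module.Free.chooseBasis ℤ L
  let w : Option (Module.Free.ChooseBasisIndex ℤ L) → E × ℝ := fun o =>
    o.elim (0, 1) fun i => ((b i : E), 0)
  have hw : ∀ o, w o ∈ liftLattice L := by
    rintro (_ | i)
    · exact mem_liftLattice.2 ⟨L.zero_mem, 1, by simp⟩
    · exact mem_liftLattice.2 ⟨(b i).2, 0, by simp⟩
  refine finite_of_bounded_of_integral (fun o => Module.Dual.eval ℝ (E × ℝ) (w o)) ?_ ?_ ?_
  · intro y hy
    have h1 : y.comp (LinearMap.inl ℝ E ℝ) = 0 :=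
      (b.ofZLatticeBasis ℝ L).ext fun i => by
        rw [Module.Basis.ofZLatticeBasis_apply]
        exact hy (some i)
    have h2 : y (0, 1) = 0 := hy none
    rw [eq_affForm y, h1, h2]
    simp [affForm]
  · intro y hy o
    exact hy.2 _ (hw o)
  · intro o
    obtain ⟨C, hC⟩ := hm.exists_abs_le (w o)
    refine ⟨k * C, ?_⟩
    rintro _ ⟨⟨y, hy, rfl⟩, -⟩
    obtain ⟨h1, h2⟩ := hm.mem_dualPolytope.1 hy
    have := hC y h1
    rw [h2, mul_one] at this
    change |(k : ℝ) * y (w o)| ≤ _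
    rw [abs_mul, Nat.abs_cast]
    exact mul_le_mul_of_nonneg_left this (Nat.cast_nonneg k)

end IsDualGrading

/-! ### Dual faces of a lattice pyramid. -/

section Pyramid

variable {B : Set E} {v : E} {f : Module.Dual ℝ E} {c : ℤ} {m : E × ℝ}

theorem affForm_mem_dualCone (h : IsHeight f c v B) (hB : Convex ℝ B) :
    affForm f ((-c : ℤ) : ℝ) ∈ dualCone (pyr v B) := by
  refine mem_dualCone.2 fun x hx => ?_
  have := h.le_apply hB hx
  rw [affForm_apply]
  push_cast
  linarith

/-- The difference is `0` at the apex and unchanged on the base, and a form is nonnegative on the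
pyramid once it is so at both. -/
theorem sub_smul_affForm_mem_dualCone (h : IsHeight f c v B) (hB : Convex ℝ B)
    {y : Module.Dual ℝ (E × ℝ)} (hy : y ∈ dualCone (pyr v B)) :
    y - y (v, 1) • affForm f ((-c : ℤ) : ℝ) ∈ dualCone (pyr v B) := by
  refine mem_dualCone.2 fun x hx => ?_
  rw [LinearMap.sub_apply, LinearMap.smul_apply, affForm_apply, smul_eq_mul]
  rcases (mem_pyr hB).1 hx with rfl | ⟨p, hp, s, h0, h1, rfl⟩
  · rw [h.apex]
    push_cast
    linarith
  · have e : (((1 - s) • p + s • v, 1) : E × ℝ) = (1 - s) • (p, 1) + s • (v, 1) := by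
      ext <;> simp
    have h2 := mul_nonneg (sub_nonneg.2 h1.le) (mem_dualCone.1 hy p (subset_pyr v B hp))
    rw [h.apply_comb hp, e, map_add, map_smul, map_smul, smul_eq_mul, smul_eq_mul]
    push_cast
    linarith

/-- As a nonzero lattice point of the dual cone, `e` has degree at least `1`. Were it larger, each
generator `y` would have `y (v, 1) < 1`, because `y - y (v, 1) • e` has nonnegative degree. By
integrality every generator, hence the whole cone, would vanish at `(v, 1)`, where `e` is `1`. -/
theorem affForm_apply_grading (h : IsHeight f c v B) (hB : Convex ℝ B) (hf : f ∈ dualLattice L)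
    (hv : v ∈ L) (hm : IsDualGrading L (pyr v B) m) : affForm f ((-c : ℤ) : ℝ) m = 1 := by
  set e := affForm f ((-c : ℤ) : ℝ) with he
  have heC : e ∈ dualCone (pyr v B) := affForm_mem_dualCone h hB
  have heL : e ∈ dualLattice (liftLattice L) := affForm_mem_dualLattice hf _
  have hev : e (v, 1) = 1 := by
    rw [he, affForm_apply, h.apex]
    push_cast
    ring
  have he0 : e ≠ 0 := fun h0 => by simp [h0] at hev
  obtain ⟨k, hk⟩ := heL m hm.1
  refine le_antisymm ?_ (hm.one_le heC heL he0)
  by_contra! hlt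
  have h0 : e (v, 1) = 0 := by
    refine hm.induction (p := fun y => y (v, 1) = 0) ?_ rfl ?_ ?_ heC
    · intro y hy hyL hy1
      have h1 := (hm.nonneg_and_eq_zero (sub_smul_affForm_mem_dualCone h hB hy)).1
      rw [LinearMap.sub_apply, LinearMap.smul_apply, ← he, hy1, smul_eq_mul] at h1
      have h2 := mem_dualCone.1 hy v (apex_mem_pyr v B)
      obtain ⟨l, hl⟩ := hyL _ (mk_one_mem_liftLattice hv)
      rw [hl] at h1 h2 ⊢
      have h3 : (l : ℝ) < 1 := by
        by_contra! h4
        nlinarith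
      have h5 : l < 1 := by exact_mod_cast h3
      have h6 : 0 ≤ l := by exact_mod_cast h2
      have : l = 0 := by omega
      simp [this]
    · intro y z h1 h2
      rw [LinearMap.add_apply, h1, h2, add_zero]
    · intro a y _ h1
      rw [LinearMap.smul_apply, h1, smul_zero]
  rw [hev] at h0
  exact one_ne_zero h0

theorem convex_dualFace (hm : IsDualGrading L Δ m) (F : Set E) : Convex ℝ (dualFace L Δ F) := by
  rintro y ⟨hy, hyF⟩ z ⟨hz, hzF⟩ a b ha hb hab
  rw [hm.mem_dualPolytope] at hy hz
  refine ⟨hm.mem_dualPolytope.2 ⟨Submodule.add_mem _ (PointedCone.smul_mem _ ha hy.1)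
    (PointedCone.smul_mem _ hb hz.1), ?_⟩, fun x hx => ?_⟩
  · simp [hy.2, hz.2, hab]
  · simp [hyF x hx, hzF x hx]

/-- The dual face of a face of the base of a lattice pyramid is a lattice pyramid. -/
theorem dualFace_eq_pyr (h : IsHeight f c v B) (hB : Convex ℝ B) (hf : f ∈ dualLattice L)
    (hv : v ∈ L) (hm : IsDualGrading L (pyr v B) m) {F : Set E} (hF : F ⊆ B) :
    dualFace L (pyr v B) F = pyr (affForm f ((-c : ℤ) : ℝ))
      {y ∈ dualFace L (pyr v B) F | y (v, 1) = 0} := by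
  have hem := affForm_apply_grading h hB hf hv hm
  have heC := affForm_mem_dualCone h hB
  have hev : affForm f ((-c : ℤ) : ℝ) (v, 1) = 1 := by
    rw [affForm_apply, h.apex]
    push_cast
    ring
  have heF : ∀ x ∈ F, affForm f ((-c : ℤ) : ℝ) (x, 1) = 0 := fun x hx => by
    rw [affForm_apply, h.base x (hF hx)]
    push_cast
    ring
  have hconv := convex_dualFace hm F
  apply Set.Subset.antisymm
  · intro y hy
    have hQ : Convex ℝ {y ∈ dualFace L (pyr v B) F | y (v, 1) = 0} :=
      hconv.inter (convex_hyperplane (Module.Dual.eval ℝ (E × ℝ) (v, 1)).isLinear 0)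
    obtain ⟨hyC, hym⟩ := hm.mem_dualPolytope.1 hy.1
    have hzC := sub_smul_affForm_mem_dualCone h hB hyC
    obtain ⟨h1, h2⟩ := hm.nonneg_and_eq_zero hzC
    rw [LinearMap.sub_apply, LinearMap.smul_apply, hem, hym, smul_eq_mul, mul_one] at h1 h2
    have hs0 := mem_dualCone.1 hyC v (apex_mem_pyr v B)
    rw [mem_pyr hQ]
    -- The height of `y` is `y (v, 1)`. At height `1` the remainder `y - e` has degree `0`, so `y`
    -- is the apex; otherwise the remainder, rescaled to degree `1`, is the base point under `y`.
    rcases (sub_nonneg.1 h1).eq_or_lt with hs | hs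
    · left
      have := h2 (by rw [hs, sub_self])
      rwa [hs, one_smul, sub_eq_zero] at this
    · right
      have hpos := sub_pos.2 hs
      refine ⟨(1 - y (v, 1))⁻¹ • (y - y (v, 1) • affForm f ((-c : ℤ) : ℝ)),
        ⟨⟨hm.mem_dualPolytope.2 ⟨PointedCone.smul_mem _ (inv_nonneg.2 h1) hzC, ?_⟩,
          fun x hx => ?_⟩, ?_⟩, y (v, 1), hs0, hs, ?_⟩
      · rw [LinearMap.smul_apply, LinearMap.sub_apply, LinearMap.smul_apply, hem, hym, smul_eq_mul,
          smul_eq_mul, mul_one, inv_mul_cancel₀ hpos.ne']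
      · rw [LinearMap.smul_apply, LinearMap.sub_apply, LinearMap.smul_apply, heF x hx, hy.2 x hx,
          smul_zero, sub_zero, smul_zero]
      · rw [LinearMap.smul_apply, LinearMap.sub_apply, LinearMap.smul_apply, hev, smul_eq_mul,
          smul_eq_mul, mul_one, sub_self, mul_zero]
      · rw [smul_inv_smul₀ hpos.ne', sub_add_cancel]
  · refine convexHull_min (Set.insert_subset ⟨hm.mem_dualPolytope.2 ⟨heC, hem⟩, heF⟩ ?_) hconv
    exact fun y hy => hy.1

theorem sTilde_dualFace [FiniteDimensional ℝ E] [DiscreteTopology L] [IsZLattice ℝ L]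
    (h : IsHeight f c v B) (hB : Convex ℝ B) (hf : f ∈ dualLattice L)
    (hv : v ∈ L) (hm : IsDualGrading L (pyr v B) m) {F : Set E} (hF : F ⊆ B) :
    sTilde (dualLattice (liftLattice L)) (dualFace L (pyr v B) F) = 0 := by
  rw [dualFace_eq_pyr h hB hf hv hm hF]
  refine sTilde_pyr (f := Module.Dual.eval ℝ (E × ℝ) (v, 1)) (c := 0)
    (eval_mem_dualLattice (mk_one_mem_liftLattice hv)) (affForm_mem_dualLattice hf _)
    ⟨fun y hy => ?_, ?_⟩ ?_ fun k => ?_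
  · rw [Int.cast_zero]
    exact hy.2
  · rw [Module.Dual.eval_apply, affForm_apply, h.apex]
    push_cast
    ring
  · exact (convex_dualFace hm F).inter
      (convex_hyperplane (Module.Dual.eval ℝ (E × ℝ) (v, 1)).isLinear 0)
  · exact (hm.finite_smul_inter k).subset (Set.inter_subset_inter_left _
      (Set.smul_set_mono fun y hy => hy.1.1))

theorem finite_smul_convexHull_inter [FiniteDimensional ℝ E] [DiscreteTopology L] {s : Set E}
    (hs : s.Finite) (k : ℝ) : (k • convexHull ℝ s ∩ (L : Set E)).Finite := by
  refine Metric.finite_isBounded_inter_isClosed DiscreteTopology.isDiscrete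
    ((hs.isCompact_convexHull (𝕜 := ℝ)).smul k).isBounded ?_
  exact AddSubgroup.isClosed_of_discrete (H := L.toAddSubgroup)

end Pyramid

end Duality

end StringyE

end

theorem mainTheorem10 {E : Type*} [NormedAddCommGroup E] [NormedSpace ℝ E] [FiniteDimensional ℝ E]
    (L : Submodule ℤ E) [DiscreteTopology L] [IsZLattice ℝ L]
    (Δ : Set E) (r : ℕ) (hΔ : StringyE.IsGorenstein L Δ r)
    (hpyr : StringyE.IsLatticePyramid L Δ) :
    StringyE.Est L Δ r = 0 := by
  obtain ⟨B, v, f, c, ⟨s, hsfin, -, rfl⟩, hv, hf, hbase, hapex, rfl⟩ := hpyr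
  obtain ⟨m, hm⟩ := hΔ.exists_isDualGrading
  set B := convexHull ℝ s
  change StringyE.IsDualGrading L (StringyE.pyr v B) m at hm
  change StringyE.Est L (StringyE.pyr v B) r = 0
  have hB : Convex ℝ B := convex_convexHull ℝ s
  have h : StringyE.IsHeight f c v B := ⟨hbase, hapex⟩
  rw [StringyE.Est, finsum_eq_zero_of_forall_eq_zero, mul_zero]
  rintro ⟨F, hF⟩
  -- The empty face falls under the second case, its dual face being all of `Δ^*`.
  by_cases hvF : v ∈ F
  · have hFB : F ∩ B ⊆ B := Set.inter_subset_right
    have h0 : StringyE.sTilde L F = 0 := by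
      rw [← hF.eq_of_apex_mem hB hvF]
      refine StringyE.sTilde_pyr hf hv (h.mono hFB) (hF.inter_base.convex hB) fun k => ?_
      exact (StringyE.finite_smul_convexHull_inter hsfin _).subset
        (Set.inter_subset_inter_left _ (Set.smul_set_mono hFB))
    simp only [h0, map_zero, mul_zero, zero_mul]
  · have hFB : F ⊆ B := Set.inter_eq_left.1 (hF.eq_of_apex_notMem hB hvF)
    simp only [StringyE.sTilde_dualFace h hB hf hv hm hFB, map_zero, mul_zero]
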